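/- For every $d\in\mathbb N$ let $A,M,N\in\mathbb R^{d\times d}$ and $b,\beta\in\mathbb R^d$ be given (all may depend on $d$), where $A$ is symmetric positive definite, $M$ and $N$ are functions of $A$ (in the sense of the spectral functional calculus), $M$ and $\mathcal A:=M-N$ are invertible and $M^T+N$ is positive definite. Put $G=M^{-1}N$. Consider the Metropolis--Hastings algorithm with target $\pi=N(A^{-1}b,A^{-1})$ and proposal $$y=Gx+M^{-1}\beta+\nu,\qquad \nu\sim N(0,\Sigma),\quad \Sigma=\mathcal A^{-1}-G\mathcal A^{-1}G^T,$$ with acceptance probability $\alpha(x,y)=1\wedge\frac{\pi(y)q(y,x)}{\pi(x)q(x,y)}$, where $\pi(\cdot)$ and $q(x,\cdot)$ are the target and proposal densities. The chain is in equilibrium: $x\sim N(A^{-1}b,A^{-1})$, and $x'$ is the next state ($x'=y$ if $u<\alpha(x,y)$ and $x'=x$ otherwise, with $u\sim U[0,1]$; $x,\nu,u$ independent). Let $A=Q\Lambda Q^T$ with $Q$ orthogonal with columns $q_1,\dots,q_d$ and $\Lambda=\operatorname{diag}(\lambda_1^2,\dots,\lambda_d^2)$, $\lambda_k>0$, and let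 $\tilde\lambda_k^2$ (a real number, possibly negative) and $G_k$ be the eigenvalues of $\mathcal A$ and $G$ for the eigenvector $q_k$. Define $$\tilde g_k=1-G_k,\quad g_k=1-G_k^2,\quad m_k=q_k^TA^{-1}b,\quad \tilde m_k=q_k^T\mathcal A^{-1}\beta,$$ $$r_k=\frac{\lambda_k^2-\tilde\lambda_k^2}{\lambda_k^2},\quad \tilde r_k=\frac{\lambda_k^2-\tilde\lambda_k^2}{\tilde\lambda_k^2},\quad \hat r_k=m_k-\tilde m_k,\quad \rho_k=\bigl(g_k(1+\tilde r_k)\bigr)^{1/2},$$ $$T_{0k}=\hat r_k^2\lambda_k^2(\tfrac12 r_kg_k-\tilde g_k),\quad T_{1k}=\hat r_k\lambda_k(r_kg_k-\tilde g_k),\quad T_{2k}=\hat r_k\lambda_k\rho_k(1-r_kG_k),$$ $$T_{3k}=\tfrac12 r_kg_k,\quad T_{4k}=-\tfrac12 r_kg_k(1+\tilde r_k),\quad T_{5k}=-r_kG_k\rho_k,$$ $$\mu_k=T_{0k}+T_{3k}+T_{4k},\qquad \sigma_k^2=T_{1k}^2+T_{2k}^2+2T_{3k}^2+2T_{4k}^2+T_{5k}^2.$$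 Suppose there is a $\delta>0$ such that for $j=1,2,3,4,5$ $$\lim_{d\to\infty}\frac{\sum_{k=1}^d|T_{jk}|^{2+\delta}}{\bigl(\sum_{k=1}^d|T_{jk}|^2\bigr)^{1+\delta/2}}=0,$$ where the quotient is read as $0$ when all $T_{jk}$, $k\le d$, vanish. Fix an index $i$. For $d\ge i$ let $$U_1=\tilde g_i^2\hat r_i^2+\frac{\tilde g_i^2}{\lambda_i^2}+\frac{g_i}{\tilde\lambda_i^2},\qquad U_2=\Phi\Bigl(\frac{\mu^-}{\sigma^-}\Bigr)+e^{\mu^-+(\sigma^-)^2/2}\,\Phi\Bigl(-\sigma^--\frac{\mu^-}{\sigma^-}\Bigr),$$ where $\mu^-=\sum_{k\le d,\,k\ne i}\mu_k$, $\sigma^-=\bigl(\sum_{k\le d,\,k\ne i}\sigma_k^2\bigr)^{1/2}$, $\Phi$ is the standard normal distribution function, and $\mu^- /\sigma^-$ is read as $0$ if $\sigma^-=0$. Then $(q_i^T(x'-x))^2$ is integrable for every $d\ge i$, and there are real numbers $U_3=U_3(d)$ such that for every $d\ge i$ $$|U_3|\le(\sigma_i^2+\mu_i^2)^{1/2}\Bigl(\tilde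 g_i^4\hat r_i^4+3\frac{\tilde g_i^4}{\lambda_i^4}+3\frac{g_i^2}{\tilde\lambda_i^4}+6\frac{\tilde g_i^4\hat r_i^2}{\lambda_i^2}+6\frac{\tilde g_i^2g_i\hat r_i^2}{\tilde\lambda_i^2}+6\frac{\tilde g_i^2g_i}{\lambda_i^2\tilde\lambda_i^2}\Bigr)^{1/2},$$ and $$\mathrm E[(q_i^T(x'-x))^2]=U_1\,(U_2+o(1))+U_3\qquad(d\to\infty).$$ In particular, if $U_1$ is bounded in $d$ (for example, constant), then $\mathrm E[(q_i^T(x'-x))^2]-(U_1U_2+U_3)\to0$ as $d\to\infty$, with the same $U_3$. -/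

import Mathlib

open MeasureTheory ProbabilityTheory Filter Topology

noncomputable section

/-- The action of a real `d × d` matrix on `ℝ^d`. -/
def act {d : ℕ} (B : Matrix (Fin d) (Fin d) ℝ) (x : EuclideanSpace ℝ (Fin d)) :
    EuclideanSpace ℝ (Fin d) :=
  Matrix.toEuclideanCLM (n := Fin d) (𝕜 := ℝ) B x

/-- The Lebesgue density at `x` of the normal distribution with mean `m` and (positive definite)
covariance matrix `S`. -/
def gaussianDensity {d : ℕ} (m : EuclideanSpace ℝ (Fin d)) (S : Matrix (Fin d) (Fin d) ℝ)
    (x : EuclideanSpace ℝ (Fin d)) : ℝ :=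
  (Real.sqrt ((2 * Real.pi) ^ d * S.det))⁻¹ *
    Real.exp (-(1 / 2) * inner ℝ (x - m) (act S⁻¹ (x - m)))

/-- The standard normal cumulative distribution function. -/
def Phi (t : ℝ) : ℝ := cdf (gaussianReal 0 1) t

/-- `B` is a function of the symmetric matrix `A` in the sense of the (spectral) functional
calculus. Every real function is continuous on the finite spectrum of `A`, so `cfc` is
`Q diag(f(a_1), …, f(a_d)) Qᵀ` whenever `A = Q diag(a_1, …, a_d) Qᵀ` with `Q` orthogonal. -/
def IsFunctionOf {d : ℕ} (B A : Matrix (Fin d) (Fin d) ℝ) : Prop :=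
  ∃ f : ℝ → ℝ, B = cfc f A

/-- The data of the Metropolis-Hastings algorithm with target `N(A⁻¹ b, A⁻¹)` and the AR(1)
proposal `M y = N x + β + ν`, `ν ∼ N(0, Mᵀ + N)`. -/
structure SplittingMH (d : ℕ) where
  A : Matrix (Fin d) (Fin d) ℝ
  M : Matrix (Fin d) (Fin d) ℝ
  N : Matrix (Fin d) (Fin d) ℝ
  b : EuclideanSpace ℝ (Fin d)
  β : EuclideanSpace ℝ (Fin d)

namespace SplittingMH

variable {d : ℕ} (P : SplittingMH d)

/-- The matrix `𝒜 = M - N` that is split. -/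
def calA : Matrix (Fin d) (Fin d) ℝ := P.M - P.N

/-- The data are meaningful: target and proposal are nondegenerate normal distributions, `G` and
`𝒜⁻¹` exist, and the splitting matrices are functions of `A`. -/
structure Admissible : Prop where
  posDef_A : P.A.PosDef
  isUnit_M : IsUnit P.M
  isUnit_calA : IsUnit P.calA
  posDef_noise : (P.M.transpose + P.N).PosDef
  function_M : IsFunctionOf P.M P.A
  function_N : IsFunctionOf P.N P.A

/-- The iteration matrix `G = M⁻¹ N`. -/
def G : Matrix (Fin d) (Fin d) ℝ := P.M⁻¹ * P.N

/-- The covariance `Σ = 𝒜⁻¹ - G 𝒜⁻¹ Gᵀ` of the proposal. -/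
def propCov : Matrix (Fin d) (Fin d) ℝ := P.calA⁻¹ - P.G * P.calA⁻¹ * P.G.transpose

/-- The mean `G x + M⁻¹ β` of the proposal from state `x`. -/
def propMean (x : EuclideanSpace ℝ (Fin d)) : EuclideanSpace ℝ (Fin d) :=
  act P.G x + act P.M⁻¹ P.β

/-- The target distribution `N(A⁻¹ b, A⁻¹)`. -/
def target : Measure (EuclideanSpace ℝ (Fin d)) :=
  multivariateGaussian (act P.A⁻¹ P.b) P.A⁻¹

/-- The target density `π(x)`. -/
def targetDensity (x : EuclideanSpace ℝ (Fin d)) : ℝ :=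
  gaussianDensity (act P.A⁻¹ P.b) P.A⁻¹ x

/-- The proposal density `q(x, y)`. -/
def propDensity (x y : EuclideanSpace ℝ (Fin d)) : ℝ :=
  gaussianDensity (P.propMean x) P.propCov y

/-- The Metropolis-Hastings acceptance probability `α(x, y)`. -/
def accept (x y : EuclideanSpace ℝ (Fin d)) : ℝ :=
  min 1 ((P.targetDensity y * P.propDensity y x) / (P.targetDensity x * P.propDensity x y))

/-- One step of the algorithm from state `x`, when the proposal noise is `ν` and the uniform random
variable of the accept/reject step is `u`. -/
def next (x ν : EuclideanSpace ℝ (Fin d)) (u : ℝ) : EuclideanSpace ℝ (Fin d) :=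
  if u < P.accept x (P.propMean x + ν) then P.propMean x + ν else x

/-- The joint law of `(x, ν, u)` in equilibrium: independent `x ∼ N(A⁻¹ b, A⁻¹)`, `ν ∼ N(0, Σ)`
and `u ∼ U[0,1]`. -/
def stepLaw :
    Measure (EuclideanSpace ℝ (Fin d) × EuclideanSpace ℝ (Fin d) × ℝ) :=
  P.target.prod ((multivariateGaussian 0 P.propCov).prod (volume.restrict (Set.Icc (0 : ℝ) 1)))

/-- The squared jump `(qᵀ (x' - x))²` as a function of `(x, ν, u)`. -/
def sqJump (q : EuclideanSpace ℝ (Fin d))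
    (w : EuclideanSpace ℝ (Fin d) × EuclideanSpace ℝ (Fin d) × ℝ) : ℝ :=
  (inner ℝ q (P.next w.1 w.2.1 w.2.2 - w.1)) ^ 2

/-- The expected squared jump size `E[(qᵀ (x' - x))²]` in equilibrium. -/
def expSqJump (q : EuclideanSpace ℝ (Fin d)) : ℝ :=
  ∫ w, P.sqJump q w ∂P.stepLaw

end SplittingMH

/-- A spectral decomposition `A = Q diag(λ_1², …, λ_d²) Qᵀ`; the columns of `Q` are the
orthonormal basis `q`. -/
structure SpectralDecomp {d : ℕ} (A : Matrix (Fin d) (Fin d) ℝ) where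
  q : OrthonormalBasis (Fin d) ℝ (EuclideanSpace ℝ (Fin d))
  lam : Fin d → ℝ
  lam_pos : ∀ k, 0 < lam k
  act_q : ∀ k, act A (q k) = (lam k) ^ 2 • q k

namespace SplittingMH

variable {d : ℕ} (P : SplittingMH d) (S : SpectralDecomp P.A)

/-- `q_kᵀ B q_k`, the eigenvalue of `B` for the eigenvector `q_k` when `B` is a function of `A`. -/
def eig (B : Matrix (Fin d) (Fin d) ℝ) (k : Fin d) : ℝ := inner ℝ (S.q k) (act B (S.q k))

/-- `λ_k²`. -/
def lam2 (k : Fin d) : ℝ := (S.lam k) ^ 2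

/-- `\tilde λ_k²`, the eigenvalue of `𝒜`. -/
def tlam2 (k : Fin d) : ℝ := P.eig S P.calA k

/-- `G_k`. -/
def Gk (k : Fin d) : ℝ := P.eig S P.G k

/-- `\tilde g_k = 1 - G_k`. -/
def tg (k : Fin d) : ℝ := 1 - P.Gk S k

/-- `g_k = 1 - G_k²`. -/
def g (k : Fin d) : ℝ := 1 - P.Gk S k ^ 2

/-- `m_k`, the coordinate of `A⁻¹ b` along `q_k`. -/
def m (k : Fin d) : ℝ := inner ℝ (S.q k) (act P.A⁻¹ P.b)

/-- `\tilde m_k`, the coordinate of `𝒜⁻¹ β` along `q_k`. -/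
def tm (k : Fin d) : ℝ := inner ℝ (S.q k) (act P.calA⁻¹ P.β)

/-- `r_k`. -/
def r (k : Fin d) : ℝ := (P.lam2 S k - P.tlam2 S k) / P.lam2 S k

/-- `\tilde r_k`. -/
def tr (k : Fin d) : ℝ := (P.lam2 S k - P.tlam2 S k) / P.tlam2 S k

/-- `\hat r_k`. -/
def hr (k : Fin d) : ℝ := P.m S k - P.tm S k

/-- `g_k^{1/2} (1 + \tilde r_k)^{1/2}`. Written with one root, it is also correct when `𝒜` has
negative eigenvalues; then `g_k` and `1 + \tilde r_k` are both negative. -/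
def root (k : Fin d) : ℝ := Real.sqrt (P.g S k * (1 + P.tr S k))

/-- The coefficients `T_{jk}`, `j = 0, …, 5`. -/
def T (j : Fin 6) (k : Fin d) : ℝ :=
  ![P.hr S k ^ 2 * P.lam2 S k * (1 / 2 * P.r S k * P.g S k - P.tg S k),
    P.hr S k * S.lam k * (P.r S k * P.g S k - P.tg S k),
    P.hr S k * S.lam k * P.root S k * (1 - P.r S k * P.Gk S k),
    1 / 2 * P.r S k * P.g S k,
    -(1 / 2) * P.r S k * P.g S k * (1 + P.tr S k),
    -P.r S k * P.Gk S k * P.root S k] j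

/-- The quotient in the Lyapunov-type condition. It is `0` if all `T_{jk}` vanish, by the
convention `0 / 0 = 0`. -/
def lyapunovRatio (δ : ℝ) (j : Fin 6) : ℝ :=
  (∑ k, |P.T S j k| ^ (2 + δ)) / (∑ k, |P.T S j k| ^ 2) ^ (1 + δ / 2)

/-- `μ_k`. -/
def mu (k : Fin d) : ℝ := P.T S 0 k + P.T S 3 k + P.T S 4 k

/-- `σ_k²`. -/
def sigma2 (k : Fin d) : ℝ :=
  P.T S 1 k ^ 2 + P.T S 2 k ^ 2 + 2 * P.T S 3 k ^ 2 + 2 * P.T S 4 k ^ 2 + P.T S 5 k ^ 2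

/-- `μ⁻ = ∑_{k ≠ i} μ_k`. -/
def muMinus (i : Fin d) : ℝ := ∑ k ∈ Finset.univ.erase i, P.mu S k

/-- `σ⁻`, the square root of `∑_{k ≠ i} σ_k²`. -/
def sigmaMinus (i : Fin d) : ℝ := Real.sqrt (∑ k ∈ Finset.univ.erase i, P.sigma2 S k)

/-- `U₁`. -/
def U1 (i : Fin d) : ℝ :=
  P.tg S i ^ 2 * P.hr S i ^ 2 + P.tg S i ^ 2 / P.lam2 S i + P.g S i / P.tlam2 S i

/-- `U₂`. -/
def U2 (i : Fin d) : ℝ :=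
  Phi (P.muMinus S i / P.sigmaMinus S i) +
    Real.exp (P.muMinus S i + P.sigmaMinus S i ^ 2 / 2) *
      Phi (-P.sigmaMinus S i - P.muMinus S i / P.sigmaMinus S i)

/-- The bound on `|U₃|`. -/
def U3bound (i : Fin d) : ℝ :=
  Real.sqrt (P.sigma2 S i + P.mu S i ^ 2) *
    Real.sqrt (P.tg S i ^ 4 * P.hr S i ^ 4
      + 3 * (P.tg S i ^ 4 / P.lam2 S i ^ 2)
      + 3 * (P.g S i ^ 2 / P.tlam2 S i ^ 2)
      + 6 * (P.tg S i ^ 4 * P.hr S i ^ 2 / P.lam2 S i)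
      + 6 * (P.tg S i ^ 2 * P.g S i * P.hr S i ^ 2 / P.tlam2 S i)
      + 6 * (P.tg S i ^ 2 * P.g S i / (P.lam2 S i * P.tlam2 S i)))

end SplittingMH

end

/-!
Since `M` and `N` are functions of `A`, every matrix of the algorithm is diagonal in the eigenbasis
`q` of `A` (`Admissible.diag`), and in standardized coordinates one step is driven by independent
pairs `(ξ_k, η_k)` of standard normal variables and the uniform variable
(`measurePreserving_stepLaw`). The proposal is reversible for the normal law with precision `𝒜`, so
the log-acceptance ratio is a sum of independent terms
`Z_k = T₀ + T₁ ξ_k + T₂ η_k + T₃ ξ_k² + T₄ η_k² + T₅ ξ_k η_k` with mean `μ_k` and variance `σ_k²`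
(`accept_eq`, `logTerm_eq`), and `E[(qᵢᵀ(x' - x))²] = E[D² (1 ∧ e^Z)]`, where `Z = ∑ Z_k` and the
proposed displacement `D` along `qᵢ` depends on `(ξ_i, η_i)` only
(`integrable_sqJump_and_expSqJump`).

Put `Z⁻ = Z - Z_i`. As `z ↦ 1 ∧ e^z` is `1`-Lipschitz, replacing `Z` by `Z⁻` costs
`U₃ = E[D² (1 ∧ e^Z - 1 ∧ e^{Z⁻})]`, which the Cauchy-Schwarz inequality bounds by
`√E[Z_i²] √E[D⁴]` (`abs_expSqJump_sub_le`). By independence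
`E[D² (1 ∧ e^{Z⁻})] = E[D²] E[1 ∧ e^{Z⁻}]`, and `E[D²] = U₁ > 0`.

It remains to show `E[1 ∧ e^{Z⁻}] - U₂ → 0`, where `U₂ = E[1 ∧ e^W]` for the normal variable `W`
with the mean and variance of `Z⁻` (`integral_min_one_exp_gaussian`). The Lyapunov condition for any
`δ > 0` implies that no single coordinate carries more than a vanishing fraction of the variance
(`sigma2_le`). As the `Z_k` are quadratic polynomials in Gaussian variables, their third moments are
controlled by their variances, so this is enough for the characteristic functions of the normalized
sums to converge (`norm_charFun_sum_chaos_sub_le`). Lévy's theorem yields weak convergence to the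
standard normal law. The mean and variance of `Z⁻` may behave arbitrarily as `d → ∞`, so the test
functions `y ↦ 1 ∧ e^{μ⁻ + σ⁻ y}` form no fixed or equicontinuous family; but they are monotone with
values in `[0, 1]`, and over such functions convergence to the normal law is uniform, as the
Lévy-Prokhorov metric shows (`tendsto_integral_sub_of_tendsto_gaussian`). If `σ⁻ = 0` then `Z⁻ = 0`,
and both sides equal `1` (`mu_eq_zero_of_sigma2_eq_zero`).
-/

noncomputable section

/-! ### Moments of the standard normal distribution -/

lemma integrable_pow_gaussianReal (n : ℕ) :
    Integrable (fun x : ℝ => x ^ n) (gaussianReal 0 1) := by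
  have h := (memLp_id_gaussianReal (μ := 0) (v := 1) (n : NNReal))
  rcases Nat.eq_zero_or_pos n with rfl | hn
  · simp
  have := h.integrable_norm_rpow (by simp; omega) (by simp)
  refine (integrable_norm_iff (by fun_prop)).1 ?_
  simpa using this

lemma integral_pow_gaussianReal_eq_iteratedDeriv (n : ℕ) :
    ∫ x, x ^ n ∂(gaussianReal 0 1) = iteratedDeriv n (fun t : ℝ => Real.exp (t ^ 2 / 2)) 0 := by
  have h := iteratedDeriv_mgf_zero (X := id) (μ := gaussianReal 0 1) (by simp) n
  rw [mgf_id_gaussianReal] at h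
  simp at h
  rw [← h]

lemma deriv_poly_mul_exp (p p' : ℝ → ℝ) (hp : ∀ t, HasDerivAt p (p' t) t) :
    deriv (fun t : ℝ => p t * Real.exp (t ^ 2 / 2)) =
      fun t => (p' t + t * p t) * Real.exp (t ^ 2 / 2) := by
  ext t
  have h1 : HasDerivAt (fun t : ℝ => t ^ 2 / 2) t t := by
    simpa using ((hasDerivAt_pow 2 t).div_const 2)
  refine ((hp t).mul h1.exp).deriv.trans ?_
  ring

lemma integral_gaussian_moments :
    (∫ x, x ^ 2 ∂(gaussianReal 0 1) = 1) ∧ (∫ x, x ^ 3 ∂(gaussianReal 0 1) = 0) ∧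
      (∫ x, x ^ 4 ∂(gaussianReal 0 1) = 3) := by
  have d0 : (fun t : ℝ => Real.exp (t ^ 2 / 2)) =
      fun t => (fun _ => (1:ℝ)) t * Real.exp (t ^ 2 / 2) := by
    simp
  have d1 : deriv (fun t : ℝ => Real.exp (t ^ 2 / 2)) = fun t => t * Real.exp (t ^ 2 / 2) := by
    rw [d0, deriv_poly_mul_exp _ (fun _ => 0) (fun t => hasDerivAt_const t _)]
    simp
  have d2 : deriv (fun t : ℝ => t * Real.exp (t ^ 2 / 2)) =
      fun t => (1 + t ^ 2) * Real.exp (t ^ 2 / 2) := by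
    rw [deriv_poly_mul_exp (fun t => t) (fun _ => 1) (fun t => hasDerivAt_id t)]
    ext; ring
  have d3 : deriv (fun t : ℝ => (1 + t ^ 2) * Real.exp (t ^ 2 / 2)) =
      fun t => (3 * t + t ^ 3) * Real.exp (t ^ 2 / 2) := by
    rw [deriv_poly_mul_exp (fun t => 1 + t ^ 2) (fun t => 2 * t)
      (fun t => by simpa using (hasDerivAt_pow 2 t).const_add 1)]
    ext; ring
  have d4 : deriv (fun t : ℝ => (3 * t + t ^ 3) * Real.exp (t ^ 2 / 2)) =
      fun t => (3 + 6 * t ^ 2 + t ^ 4) * Real.exp (t ^ 2 / 2) := by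
    rw [deriv_poly_mul_exp (fun t => 3 * t + t ^ 3) (fun t => 3 + 3 * t ^ 2)
      (fun t => (((hasDerivAt_id t).const_mul 3).add (hasDerivAt_pow 3 t)).congr_deriv
        (by simp))]
    ext; ring
  refine ⟨?_, ?_, ?_⟩ <;> rw [integral_pow_gaussianReal_eq_iteratedDeriv] <;>
    simp [iteratedDeriv_succ, iteratedDeriv_zero, d1, d2, d3, d4]

/-- The law of a pair of independent standard normal variables: one drives the state and one the
proposal noise of a single coordinate. -/
def gaussianPair : Measure (ℝ × ℝ) := (gaussianReal 0 1).prod (gaussianReal 0 1)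

instance : IsProbabilityMeasure gaussianPair := by unfold gaussianPair; infer_instance

lemma integrable_monomial_gaussianPair (m n : ℕ) :
    Integrable (fun p : ℝ × ℝ => p.1 ^ m * p.2 ^ n) gaussianPair :=
  (integrable_pow_gaussianReal m).mul_prod (integrable_pow_gaussianReal n)

lemma integral_monomial_gaussianPair (m n : ℕ) :
    ∫ p : ℝ × ℝ, p.1 ^ m * p.2 ^ n ∂gaussianPair =
      (∫ x, x ^ m ∂(gaussianReal 0 1)) * ∫ x, x ^ n ∂(gaussianReal 0 1) :=
  integral_prod_mul (fun x : ℝ => x ^ m) (fun x : ℝ => x ^ n)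

/-- A polynomial of degree at most `4` in each of two independent standard normal variables may be
integrated monomial by monomial. -/
lemma integral_polynomial_gaussianPair (c : Fin 5 → Fin 5 → ℝ) (f : ℝ × ℝ → ℝ)
    (hf : ∀ p, f p = ∑ m : Fin 5, ∑ n : Fin 5, c m n * (p.1 ^ (m : ℕ) * p.2 ^ (n : ℕ))) :
    Integrable f gaussianPair ∧ ∫ p, f p ∂gaussianPair =
      (c 0 0 + c 0 2 + 3 * c 0 4) + (c 2 0 + c 2 2 + 3 * c 2 4)
        + 3 * (c 4 0 + c 4 2 + 3 * c 4 4) := by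
  have hf' : f = fun p => ∑ m : Fin 5, ∑ n : Fin 5, c m n * (p.1 ^ (m : ℕ) * p.2 ^ (n : ℕ)) :=
    funext hf
  have hi : ∀ m n : Fin 5, Integrable
      (fun p : ℝ × ℝ => c m n * (p.1 ^ (m : ℕ) * p.2 ^ (n : ℕ))) gaussianPair :=
    fun m n => (integrable_monomial_gaussianPair m n).const_mul _
  constructor
  · rw [hf']
    exact integrable_finsetSum _ fun m _ => integrable_finsetSum _ fun n _ => hi m n
  · rw [hf', integral_finsetSum _ fun m _ => integrable_finsetSum _ fun n _ => hi m n]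
    simp_rw [integral_finsetSum _ fun n _ => hi _ n, integral_const_mul,
      integral_monomial_gaussianPair]
    obtain ⟨h2, h3, h4⟩ := integral_gaussian_moments
    have e0 : ∫ x : ℝ, x ^ 0 ∂(gaussianReal 0 1) = 1 := by simp
    have e1 : ∫ x : ℝ, x ^ 1 ∂(gaussianReal 0 1) = 0 := by simp
    simp only [Fin.sum_univ_five, Fin.isValue, Fin.val_zero, Fin.val_one, Fin.val_two,
      show ((3 : Fin 5) : ℕ) = 3 from rfl, show ((4 : Fin 5) : ℕ) = 4 from rfl, e0, e1, h2, h3, h4]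
    ring

/-! ### A central limit theorem for quadratic forms in Gaussian pairs -/

/-- The centred quadratic polynomial
`c₀ ξ + c₁ η + c₂ (ξ² - 1) + c₃ (η² - 1) + c₄ ξ η` in `p = (ξ, η)`. -/
def chaos (c : Fin 5 → ℝ) (p : ℝ × ℝ) : ℝ :=
  c 0 * p.1 + c 1 * p.2 + c 2 * (p.1 ^ 2 - 1) + c 3 * (p.2 ^ 2 - 1) + c 4 * (p.1 * p.2)

/-- The variance of `chaos c` under `gaussianPair`. -/
def chaosVar (c : Fin 5 → ℝ) : ℝ :=
  c 0 ^ 2 + c 1 ^ 2 + 2 * c 2 ^ 2 + 2 * c 3 ^ 2 + c 4 ^ 2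

@[fun_prop]
lemma continuous_chaos (c : Fin 5 → ℝ) : Continuous (chaos c) := by
  unfold chaos; fun_prop

lemma chaosVar_nonneg (c : Fin 5 → ℝ) : 0 ≤ chaosVar c := by unfold chaosVar; positivity

lemma chaos_mean (c : Fin 5 → ℝ) :
    Integrable (chaos c) gaussianPair ∧ ∫ p, chaos c p ∂gaussianPair = 0 := by
  have := integral_polynomial_gaussianPair
    ![![-c 2 - c 3, c 1, c 3, 0, 0], ![c 0, c 4, 0, 0, 0], ![c 2, 0, 0, 0, 0], 0, 0] (chaos c)
    (fun p => by simp [Fin.sum_univ_five, chaos]; ring)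
  refine ⟨this.1, this.2.trans ?_⟩
  simp

lemma chaos_second_moment (c : Fin 5 → ℝ) (a : ℝ) :
    Integrable (fun p => (a + chaos c p) ^ 2) gaussianPair ∧
      ∫ p, (a + chaos c p) ^ 2 ∂gaussianPair = a ^ 2 + chaosVar c := by
  have := integral_polynomial_gaussianPair
    ![![(a - c 2 - c 3) ^ 2, 2 * (a - c 2 - c 3) * c 1, c 1 ^ 2 + 2 * (a - c 2 - c 3) * c 3,
          2 * c 1 * c 3, c 3 ^ 2],
      ![2 * (a - c 2 - c 3) * c 0, 2 * (a - c 2 - c 3) * c 4 + 2 * c 0 * c 1,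
          2 * c 0 * c 3 + 2 * c 1 * c 4, 2 * c 3 * c 4, 0],
      ![c 0 ^ 2 + 2 * (a - c 2 - c 3) * c 2, 2 * c 0 * c 4 + 2 * c 1 * c 2,
          c 4 ^ 2 + 2 * c 2 * c 3, 0, 0],
      ![2 * c 0 * c 2, 2 * c 2 * c 4, 0, 0, 0],
      ![c 2 ^ 2, 0, 0, 0, 0]] (fun p => (a + chaos c p) ^ 2)
    (fun p => by simp [Fin.sum_univ_five, chaos]; ring)
  refine ⟨this.1, this.2.trans ?_⟩
  simp [chaosVar]
  ring

lemma abs_chaos_le (c : Fin 5 → ℝ) (p : ℝ × ℝ) :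
    |chaos c p| ≤ √(chaosVar c) * (5 * ((1 + p.1 ^ 2) * (1 + p.2 ^ 2))) := by
  have hc : ∀ j, |c j| ≤ √(chaosVar c) := by
    intro j
    apply Real.abs_le_sqrt
    unfold chaosVar
    fin_cases j <;> simp <;> nlinarith [sq_nonneg (c 0), sq_nonneg (c 1), sq_nonneg (c 2),
      sq_nonneg (c 3), sq_nonneg (c 4)]
  set x := p.1
  set y := p.2
  have hx := sq_nonneg x
  have hy := sq_nonneg y
  have hxy : 0 ≤ x ^ 2 * y ^ 2 := by positivity
  have key : ∀ j, ∀ z : ℝ, |z| ≤ (1 + x ^ 2) * (1 + y ^ 2) →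
      |c j * z| ≤ √(chaosVar c) * ((1 + x ^ 2) * (1 + y ^ 2)) := by
    intro j z hz
    rw [abs_mul]
    exact mul_le_mul (hc j) hz (abs_nonneg _) (Real.sqrt_nonneg _)
  have h0 := key 0 x (by rw [abs_le]; constructor <;> nlinarith)
  have h1 := key 1 y (by rw [abs_le]; constructor <;> nlinarith)
  have h2 := key 2 (x ^ 2 - 1) (by rw [abs_le]; constructor <;> nlinarith)
  have h3 := key 3 (y ^ 2 - 1) (by rw [abs_le]; constructor <;> nlinarith)
  have h4 := key 4 (x * y) (by
    rw [abs_le]; constructor <;>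
      nlinarith [sq_nonneg (x + y), sq_nonneg (x - y)])
  unfold chaos
  rw [abs_le] at *
  constructor <;> linarith [h0.1, h0.2, h1.1, h1.2, h2.1, h2.2, h3.1, h3.2, h4.1, h4.2]

/-- The second order Taylor bound; the estimate by the terms themselves covers `|x| > 1`. -/
lemma norm_exp_I_sub_taylor_le (x : ℝ) :
    ‖Complex.exp (x * Complex.I) - (1 + x * Complex.I - x ^ 2 / 2)‖ ≤ 4 * |x| ^ 3 := by
  have hI : (x * Complex.I) ^ 2 = -(x : ℂ) ^ 2 := by rw [mul_pow, Complex.I_sq]; ring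
  rcases le_or_gt |x| 1 with hx | hx
  · have h := Complex.exp_bound (x := x * Complex.I) (by simpa using hx) (n := 3) (by norm_num)
    simp [Finset.sum_range_succ, Nat.factorial, hI] at h
    calc _ = ‖Complex.exp (x * Complex.I) - (1 + x * Complex.I + -(x : ℂ) ^ 2 / 2)‖ := by
          congr 2; ring
      _ ≤ _ := h
      _ ≤ _ := by nlinarith [abs_nonneg x, pow_nonneg (abs_nonneg x) 3]
  · have h1 : ‖Complex.exp (x * Complex.I)‖ = 1 := Complex.norm_exp_ofReal_mul_I x
    calc _ ≤ ‖Complex.exp (x * Complex.I)‖ + (‖(1 : ℂ)‖ + ‖x * Complex.I‖ + ‖(x : ℂ) ^ 2 / 2‖) := by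
          refine (norm_sub_le _ _).trans (add_le_add_right ((norm_sub_le _ _).trans
            (add_le_add_left (norm_add_le _ _) _)) _)
      _ = 2 + |x| + |x| ^ 2 / 2 := by rw [h1]; simp; ring
      _ ≤ 4 * |x| ^ 3 := by nlinarith [mul_pos (sub_pos.2 hx) (sub_pos.2 hx), sq_nonneg |x|]

/-- The third moment of the polynomial that dominates every `chaos c` of unit variance. -/
def chaosConst : ℝ := ∫ p : ℝ × ℝ, (5 * ((1 + p.1 ^ 2) * (1 + p.2 ^ 2))) ^ 3 ∂gaussianPair

lemma integrable_dominating_cube :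
    Integrable (fun p : ℝ × ℝ => (5 * ((1 + p.1 ^ 2) * (1 + p.2 ^ 2))) ^ 3) gaussianPair := by
  have h : Integrable (fun x : ℝ => (1 + x ^ 2) ^ 3) (gaussianReal 0 1) := by
    have : (fun x : ℝ => (1 + x ^ 2) ^ 3) = fun x => x ^ 0 + 3 * x ^ 2 + 3 * x ^ 4 + x ^ 6 := by
      ext; ring
    rw [this]
    exact (((integrable_pow_gaussianReal 0).add ((integrable_pow_gaussianReal 2).const_mul 3)).add
      ((integrable_pow_gaussianReal 4).const_mul 3)).add (integrable_pow_gaussianReal 6)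
  have h' : (fun p : ℝ × ℝ => (5 * ((1 + p.1 ^ 2) * (1 + p.2 ^ 2))) ^ 3)
      = fun p => 125 * ((1 + p.1 ^ 2) ^ 3 * (1 + p.2 ^ 2) ^ 3) := by ext; ring
  rw [h']
  exact (h.mul_prod h).const_mul 125

lemma chaosConst_nonneg : 0 ≤ chaosConst :=
  integral_nonneg fun p => by positivity

/-- The second order Taylor expansion of the characteristic function of `chaos c`. -/
lemma norm_charFun_chaos_sub_le (c : Fin 5 → ℝ) (s : ℝ) :
    ‖∫ p, Complex.exp ((s * chaos c p : ℝ) * Complex.I) ∂gaussianPair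
        - ((1 - s ^ 2 * chaosVar c / 2 : ℝ) : ℂ)‖
      ≤ 4 * |s| ^ 3 * √(chaosVar c) ^ 3 * chaosConst := by
  have hint1 : Integrable (fun p => Complex.exp ((s * chaos c p : ℝ) * Complex.I))
      gaussianPair := by
    refine Integrable.of_bound (by fun_prop) 1 (Eventually.of_forall fun p => ?_)
    rw [Complex.norm_exp_ofReal_mul_I]
  obtain ⟨i1, e1⟩ := chaos_mean c
  obtain ⟨i2, e2⟩ := chaos_second_moment c 0
  simp only [zero_add, ne_eq, OfNat.ofNat_ne_zero, not_false_eq_true, zero_pow] at i2 e2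
  have hint2 : Integrable (fun p => ((1 : ℂ) + (s * chaos c p : ℝ) * Complex.I
      - ((s * chaos c p : ℝ) : ℂ) ^ 2 / 2)) gaussianPair := by
    refine ((integrable_const _).add ((i1.const_mul s).ofReal.mul_const _)).sub ?_
    refine Integrable.div_const ?_ _
    have : (fun p => ((s * chaos c p : ℝ) : ℂ) ^ 2) =
        fun p => ((s ^ 2 * chaos c p ^ 2 : ℝ) : ℂ) := by
      ext; push_cast; ring
    rw [this]
    exact (i2.const_mul _).ofReal
  have e3 : ∫ p, ((1 : ℂ) + (s * chaos c p : ℝ) * Complex.I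
      - ((s * chaos c p : ℝ) : ℂ) ^ 2 / 2) ∂gaussianPair
      = ((1 - s ^ 2 * chaosVar c / 2 : ℝ) : ℂ) := by
    have : (fun p => ((1 : ℂ) + (s * chaos c p : ℝ) * Complex.I
          - ((s * chaos c p : ℝ) : ℂ) ^ 2 / 2))
        = fun p => ((1 - s ^ 2 / 2 * chaos c p ^ 2 : ℝ) : ℂ)
          + ((s * chaos c p : ℝ) : ℂ) * Complex.I := by
      ext; push_cast; ring
    rw [this, integral_add, integral_mul_const, integral_complex_ofReal, integral_complex_ofReal,
      integral_const_mul, e1, integral_sub (integrable_const _) (i2.const_mul _),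
      integral_const_mul, e2]
    · simp; ring
    · exact ((integrable_const _).sub (i2.const_mul _)).ofReal
    · exact (i1.const_mul s).ofReal.mul_const _
  rw [← e3, ← integral_sub hint1 hint2]
  calc _ ≤ ∫ p : ℝ × ℝ, 4 * |s| ^ 3 * √(chaosVar c) ^ 3 *
          (5 * ((1 + p.1 ^ 2) * (1 + p.2 ^ 2))) ^ 3 ∂gaussianPair := by
        refine norm_integral_le_of_norm_le (integrable_dominating_cube.const_mul _)
          (Eventually.of_forall fun p => ?_)
        refine (norm_exp_I_sub_taylor_le _).trans ?_
        rw [abs_mul, mul_pow, mul_assoc 4, mul_assoc 4, mul_assoc (|s| ^ 3), ← mul_pow (√_)]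
        gcongr
        exact abs_chaos_le c p
    _ = _ := integral_const_mul _ _

/-- The variance-matched Gaussian has the same second order expansion, being itself a `chaos`. -/
lemma norm_charFun_chaos_sub_gaussian_le (c : Fin 5 → ℝ) (s : ℝ) :
    ‖∫ p, Complex.exp ((s * chaos c p : ℝ) * Complex.I) ∂gaussianPair
        - ((Real.exp (-(s ^ 2 * chaosVar c / 2)) : ℝ) : ℂ)‖
      ≤ 8 * |s| ^ 3 * √(chaosVar c) ^ 3 * chaosConst := by
  have h1 := norm_charFun_chaos_sub_le c s
  have hv : chaosVar ![√(chaosVar c), 0, 0, 0, 0] = chaosVar c := by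
    have h := Real.sq_sqrt (chaosVar_nonneg c)
    conv_lhs => rw [chaosVar]
    simpa using h
  have h2 := norm_charFun_chaos_sub_le ![√(chaosVar c), 0, 0, 0, 0] s
  have h3 : ∫ p, Complex.exp ((s * chaos ![√(chaosVar c), 0, 0, 0, 0] p : ℝ) * Complex.I)
        ∂gaussianPair
      = ((Real.exp (-(s ^ 2 * chaosVar c / 2)) : ℝ) : ℂ) := by
    have : ∀ p : ℝ × ℝ, Complex.exp ((s * chaos ![√(chaosVar c), 0, 0, 0, 0] p : ℝ) * Complex.I)
        = Complex.exp ((s * √(chaosVar c) : ℝ) * p.1 * Complex.I) := by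
      intro p; simp [chaos]; ring_nf
    simp_rw [this]
    have h := integral_fun_fst (μ := gaussianReal 0 1) (ν := gaussianReal 0 1)
      (fun x : ℝ => Complex.exp ((s * √(chaosVar c) : ℝ) * x * Complex.I))
    rw [gaussianPair, h, ← charFun_apply_real, charFun_gaussianReal]
    have hsq : (√(chaosVar c)) ^ 2 = chaosVar c := Real.sq_sqrt (chaosVar_nonneg c)
    simp only [probReal_univ, one_smul]
    rw [Complex.ofReal_exp]
    congr 1
    rw [← hsq]
    rw [Real.sqrt_sq (Real.sqrt_nonneg _)]
    push_cast; ring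
  rw [hv, h3, norm_sub_rev] at h2
  calc _ ≤ _ := norm_sub_le_norm_sub_add_norm_sub _ _ _
    _ ≤ _ := add_le_add h1 h2
    _ = _ := by ring

lemma norm_prod_sub_prod_le_sum {ι : Type*} (s : Finset ι) (a b : ι → ℂ)
    (ha : ∀ k, ‖a k‖ ≤ 1) (hb : ∀ k, ‖b k‖ ≤ 1) :
    ‖∏ k ∈ s, a k - ∏ k ∈ s, b k‖ ≤ ∑ k ∈ s, ‖a k - b k‖ := by
  classical
  induction s using Finset.induction_on with
  | empty => simp
  | insert i s hi ih =>
    rw [Finset.prod_insert hi, Finset.prod_insert hi, Finset.sum_insert hi]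
    have : a i * ∏ k ∈ s, a k - b i * ∏ k ∈ s, b k
        = (a i - b i) * ∏ k ∈ s, a k + b i * (∏ k ∈ s, a k - ∏ k ∈ s, b k) := by ring
    rw [this]
    refine (norm_add_le _ _).trans ?_
    rw [norm_mul, norm_mul]
    have hp : ‖∏ k ∈ s, a k‖ ≤ 1 := by
      rw [norm_prod]; exact Finset.prod_le_one (fun _ _ => norm_nonneg _) (fun k _ => ha k)
    have := mul_le_of_le_one_right (norm_nonneg (a i - b i)) hp
    have := mul_le_of_le_one_left (norm_nonneg (∏ k ∈ s, a k - ∏ k ∈ s, b k)) (hb i)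
    linarith

/-- Gaussian approximation of the characteristic function of a normalized sum of independent
`chaos` variables, none of which carries more than a fraction `ε` of the variance. -/
lemma norm_charFun_sum_chaos_sub_le {ι : Type*} [Fintype ι] (c : ι → Fin 5 → ℝ) (V ε : ℝ)
    (hV : V = ∑ k, chaosVar (c k)) (hV0 : 0 < V) (hε : ∀ k, chaosVar (c k) ≤ ε * V) (t : ℝ) :
    ‖charFun ((Measure.pi fun _ : ι => gaussianPair).map
        (fun ω => (∑ k, chaos (c k) (ω k)) / √V)) t - charFun (gaussianReal 0 1) t‖
      ≤ 8 * |t| ^ 3 * chaosConst * √ε := by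
  have hm : Measurable (fun ω : ι → ℝ × ℝ => (∑ k, chaos (c k) (ω k)) / √V) := by fun_prop
  set s := t / √V with hs
  have hsV : 0 < √V := Real.sqrt_pos.2 hV0
  have hVV : √V ^ 2 = V := Real.sq_sqrt hV0.le
  have e1 : charFun ((Measure.pi fun _ : ι => gaussianPair).map
        (fun ω => (∑ k, chaos (c k) (ω k)) / √V)) t
      = ∏ k, ∫ p, Complex.exp ((s * chaos (c k) p : ℝ) * Complex.I) ∂gaussianPair := by
    rw [charFun_apply_real, integral_map hm.aemeasurable (by fun_prop),
      ← integral_fintype_prod_eq_prod]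
    congr 1
    ext ω
    rw [← Complex.exp_sum, ← Finset.sum_mul, ← Complex.ofReal_sum, ← Complex.ofReal_mul,
      ← Finset.mul_sum]
    congr 3
    rw [hs]; ring
  have e2 : charFun (gaussianReal 0 1) t
      = ∏ k, ((Real.exp (-(s ^ 2 * chaosVar (c k) / 2)) : ℝ) : ℂ) := by
    rw [charFun_gaussianReal, ← Complex.ofReal_prod, ← Real.exp_sum, Finset.sum_neg_distrib,
      ← Finset.sum_div, ← Finset.mul_sum, ← hV, hs, div_pow, hVV, div_mul_cancel₀ _ hV0.ne']
    push_cast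
    congr 1
    simp
  rw [e1, e2]
  refine (norm_prod_sub_prod_le_sum _ _ _ (fun k => ?_) (fun k => ?_)).trans ?_
  · refine (norm_integral_le_integral_norm _).trans ?_
    simp_rw [Complex.norm_exp_ofReal_mul_I]
    simp
  · rw [Complex.norm_real, Real.norm_eq_abs, abs_of_nonneg (Real.exp_nonneg _), Real.exp_le_one_iff]
    have := mul_nonneg (sq_nonneg s) (chaosVar_nonneg (c k))
    linarith
  · calc _ ≤ ∑ k, 8 * |s| ^ 3 * chaosConst * (√ε * √V) * chaosVar (c k) := by
          refine Finset.sum_le_sum fun k _ => (norm_charFun_chaos_sub_gaussian_le _ _).trans ?_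
          have h1 : √(chaosVar (c k)) ≤ √ε * √V := by
            rw [← Real.sqrt_mul' _ hV0.le]; exact Real.sqrt_le_sqrt (hε k)
          have h2 : √(chaosVar (c k)) ^ 3 = √(chaosVar (c k)) * chaosVar (c k) := by
            rw [pow_succ', Real.sq_sqrt (chaosVar_nonneg _)]
          have h3 : √(chaosVar (c k)) * chaosVar (c k) ≤ √ε * √V * chaosVar (c k) :=
            mul_le_mul_of_nonneg_right h1 (chaosVar_nonneg _)
          have h4 : 0 ≤ 8 * |s| ^ 3 * chaosConst := mul_nonneg (by positivity) chaosConst_nonneg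
          rw [h2]
          nlinarith [mul_le_mul_of_nonneg_left h3 h4]
      _ = 8 * |s| ^ 3 * chaosConst * (√ε * √V) * V := by rw [← Finset.mul_sum, ← hV]
      _ = _ := by
          rw [hs, abs_div, abs_of_pos hsV, div_pow]
          conv_lhs => rw [← hVV]
          rw [Real.sqrt_sq hsV.le]
          field_simp

/-! ### Uniformity of weak convergence to the normal law over monotone functions -/

lemma gaussianReal_le_volume : gaussianReal 0 1 ≤ (volume : Measure ℝ) := by
  rw [gaussianReal_of_var_ne_zero 0 one_ne_zero]
  calc volume.withDensity (gaussianPDF 0 1) ≤ volume.withDensity 1 := by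
        refine withDensity_mono (Eventually.of_forall fun x => ?_)
        rw [gaussianPDF_def]
        simp only [Pi.one_apply, ENNReal.ofReal_le_one, gaussianPDFReal]
        have h1 : (√(2 * Real.pi * ((1 : NNReal) : ℝ)))⁻¹ ≤ 1 := by
          refine inv_le_one_of_one_le₀ (Real.one_le_sqrt.2 ?_)
          have := Real.pi_gt_three
          simp; linarith
        have h2 : Real.exp (-(x - 0) ^ 2 / (2 * ((1 : NNReal) : ℝ))) ≤ 1 := by
          rw [Real.exp_le_one_iff]
          exact div_nonpos_of_nonpos_of_nonneg (neg_nonpos.2 (sq_nonneg _)) (by simp)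
        exact mul_le_one₀ h1 (Real.exp_nonneg _) h2
    _ = volume := withDensity_one

/-- Thickening an order-connected set adds at most an interval of length `ε` at either end. -/
lemma gaussianReal_thickening_le {S : Set ℝ} (hS : S.OrdConnected) (ε : ℝ) :
    gaussianReal 0 1 (Metric.thickening ε S) ≤
      gaussianReal 0 1 S + (ENNReal.ofReal ε + ENNReal.ofReal ε) := by
  set L := {x | x ∈ Metric.thickening ε S ∧ ∀ s ∈ S, x ≤ s}
  set U := {x | x ∈ Metric.thickening ε S ∧ ∀ s ∈ S, s ≤ x}
  have hsub : Metric.thickening ε S ⊆ S ∪ (L ∪ U) := by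
    intro x hx
    obtain ⟨s, hs, hxs⟩ := Metric.mem_thickening_iff.1 hx
    by_cases hxS : x ∈ S
    · exact Or.inl hxS
    right
    rcases le_total x s with h | h
    · refine Or.inl ⟨hx, fun s' hs' => ?_⟩
      by_contra! h'
      exact hxS (hS.out hs' hs ⟨h'.le, h⟩)
    · refine Or.inr ⟨hx, fun s' hs' => ?_⟩
      by_contra! h'
      exact hxS (hS.out hs hs' ⟨h, h'.le⟩)
  have hL : gaussianReal 0 1 L ≤ ENNReal.ofReal ε := by
    refine (gaussianReal_le_volume L).trans ((Real.volume_le_diam L).trans ?_)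
    refine Metric.ediam_le fun x hx y hy => ?_
    rw [edist_dist]
    refine ENNReal.ofReal_le_ofReal ?_
    obtain ⟨s, hs, hxs⟩ := Metric.mem_thickening_iff.1 hx.1
    obtain ⟨s', hs', hys⟩ := Metric.mem_thickening_iff.1 hy.1
    rw [Real.dist_eq, abs_lt] at hxs hys
    rw [Real.dist_eq, abs_le]
    constructor <;> linarith [hx.2 s' hs', hy.2 s hs]
  have hU : gaussianReal 0 1 U ≤ ENNReal.ofReal ε := by
    refine (gaussianReal_le_volume U).trans ((Real.volume_le_diam U).trans ?_)
    refine Metric.ediam_le fun x hx y hy => ?_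
    rw [edist_dist]
    refine ENNReal.ofReal_le_ofReal ?_
    obtain ⟨s, hs, hxs⟩ := Metric.mem_thickening_iff.1 hx.1
    obtain ⟨s', hs', hys⟩ := Metric.mem_thickening_iff.1 hy.1
    rw [Real.dist_eq, abs_lt] at hxs hys
    rw [Real.dist_eq, abs_le]
    constructor <;> linarith [hx.2 s' hs', hy.2 s hs]
  calc _ ≤ gaussianReal 0 1 (S ∪ (L ∪ U)) := measure_mono hsub
    _ ≤ _ := (measure_union_le _ _).trans (by
      gcongr; exact (measure_union_le _ _).trans (by gcongr))

/-- The superlevel sets of a monotone function are order-connected, so a small Lévy-Prokhorov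
distance to the normal law controls the integral, at a rate independent of the function. -/
lemma integral_le_of_levyProkhorov_gaussian (P : Measure ℝ) [IsProbabilityMeasure P] {ε : ℝ}
    (hε : 0 < ε) (hP : levyProkhorovEDist P (gaussianReal 0 1) < ENNReal.ofReal ε)
    (F : BoundedContinuousFunction ℝ ℝ) (h0 : ∀ x, 0 ≤ F x) (h1 : ∀ x, F x ≤ 1)
    (hF : Monotone F ∨ Antitone F) :
    ∫ x, F x ∂P ≤ ∫ x, F x ∂(gaussianReal 0 1) + 3 * ε := by
  have hnorm : ‖F‖ ≤ 1 := by
    refine (BoundedContinuousFunction.norm_le zero_le_one).2 fun x => ?_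
    rw [Real.norm_eq_abs, abs_of_nonneg (h0 x)]; exact h1 x
  have hS : ∀ t, {a | t ≤ F a}.OrdConnected := by
    intro t
    rcases hF with hF | hF
    · exact (show IsUpperSet {a | t ≤ F a} from
        fun a b hab (ha : t ≤ F a) => ha.trans (hF hab)).ordConnected
    · exact (show IsLowerSet {a | t ≤ F a} from
        fun a b hab (ha : t ≤ F a) => ha.trans (hF hab)).ordConnected
  refine (BoundedContinuousFunction.integral_le_of_levyProkhorovEDist_lt P (gaussianReal 0 1) hε hP
    F (Eventually.of_forall h0)).trans ?_
  rw [BoundedContinuousFunction.integral_eq_integral_meas_le F (gaussianReal 0 1)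
    (Eventually.of_forall h0)]
  have hint : IntegrableOn (fun t => (gaussianReal 0 1).real {a | t ≤ F a}) (Set.Ioc 0 ‖F‖) := by
    apply Measure.integrableOn_of_bounded (M := 1) measure_Ioc_lt_top.ne
    · apply (Measurable.ennreal_toReal (Antitone.measurable ?_)).aestronglyMeasurable
      exact fun _ _ hst => measure_mono (fun _ h => hst.trans h)
    · refine Eventually.of_forall fun t => ?_
      simp only [Real.norm_eq_abs, abs_of_nonneg measureReal_nonneg]
      exact measureReal_le_one
  have hle : ∫ t in Set.Ioc 0 ‖F‖, (gaussianReal 0 1).real (Metric.thickening ε {a | t ≤ F a})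
      ≤ ∫ t in Set.Ioc 0 ‖F‖, ((gaussianReal 0 1).real {a | t ≤ F a} + 2 * ε) := by
    refine integral_mono_of_nonneg (Eventually.of_forall fun t => measureReal_nonneg)
      (hint.add (integrable_const _)) (Eventually.of_forall fun t => ?_)
    have h := gaussianReal_thickening_le (hS t) ε
    rw [← ENNReal.ofReal_add hε.le hε.le, ← two_mul] at h
    have := ENNReal.toReal_mono (by finiteness) h
    rwa [ENNReal.toReal_add (by finiteness) (by finiteness),
      ENNReal.toReal_ofReal (by positivity)] at this
  rw [integral_add hint (integrable_const _)] at hle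
  simp only [integral_const, MeasurableSet.univ, measureReal_restrict_apply, Set.univ_inter,
    Real.volume_real_Ioc, sub_zero, smul_eq_mul, max_eq_left (norm_nonneg F)] at hle
  nlinarith [norm_nonneg F]

/-- Weak convergence to the standard normal law is uniform over monotone functions with values in
`[0, 1]`; in particular the test function may vary along the sequence. -/
theorem tendsto_integral_sub_of_tendsto_gaussian (P : ℕ → ProbabilityMeasure ℝ)
    (hP : Tendsto P atTop (𝓝 ⟨gaussianReal 0 1, inferInstance⟩)) (F : ℕ → ℝ → ℝ)
    (hc : ∀ n, Continuous (F n)) (hm : ∀ n, Monotone (F n)) (h0 : ∀ n x, 0 ≤ F n x)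
    (h1 : ∀ n x, F n x ≤ 1) :
    Tendsto (fun n => ∫ x, F n x ∂(P n : Measure ℝ) - ∫ x, F n x ∂(gaussianReal 0 1))
      atTop (𝓝 0) := by
  have hLP : Tendsto (fun n => levyProkhorovEDist (P n : Measure ℝ) (gaussianReal 0 1)) atTop
      (𝓝 0) := by
    have h := (LevyProkhorov.probabilityMeasureHomeomorph (Ω := ℝ)).continuous.tendsto
      ⟨gaussianReal 0 1, inferInstance⟩ |>.comp hP
    have h' := tendsto_iff_edist_tendsto_0.1 h
    refine h'.congr fun n => ?_
    simp only [Function.comp_apply, edist_dist, LevyProkhorov.dist_probabilityMeasure_def]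
    rw [levyProkhorovDist, ENNReal.ofReal_toReal (levyProkhorovEDist_ne_top _ _)]
    rfl
  rw [Metric.tendsto_atTop]
  intro δ hδ
  have hδ' : 0 < ENNReal.ofReal (δ / 4) := by simpa using hδ
  obtain ⟨N, hN⟩ := eventually_atTop.1 (hLP.eventually (gt_mem_nhds hδ'))
  refine ⟨N, fun n hn => ?_⟩
  have hb : ∀ x y, dist (F n x) (F n y) ≤ 1 := fun x y => by
    rw [Real.dist_eq, abs_le]
    constructor <;> linarith [h0 n x, h0 n y, h1 n x, h1 n y]
  let f : BoundedContinuousFunction ℝ ℝ := BoundedContinuousFunction.mkOfBound ⟨F n, hc n⟩ 1 hb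
  have hf : ∀ x, f x = F n x := fun _ => rfl
  have a1 := integral_le_of_levyProkhorov_gaussian (P n : Measure ℝ) (by positivity) (hN n hn) f
    (h0 n) (h1 n) (Or.inl (hm n))
  -- the lower bound comes from the antitone function `1 - f`
  have a2 := integral_le_of_levyProkhorov_gaussian (P n : Measure ℝ) (by positivity) (hN n hn)
    (1 - f) (fun x => sub_nonneg.2 (h1 n x)) (fun x => sub_le_self _ (h0 n x))
    (Or.inr fun x y hxy => sub_le_sub_left (hm n hxy) 1)
  have e : ∀ (Q : Measure ℝ) [IsProbabilityMeasure Q], ∫ x, (1 - f) x ∂Q = 1 - ∫ x, f x ∂Q := by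
    intro Q _
    simp only [BoundedContinuousFunction.coe_sub, Pi.sub_apply, BoundedContinuousFunction.coe_one,
      Pi.one_apply]
    rw [integral_sub (integrable_const _) (f.integrable Q)]
    simp
  rw [e, e] at a2
  simp only [hf] at a1 a2
  rw [Real.dist_eq, sub_zero, abs_lt]
  constructor <;> linarith

/-! ### The expectation of `1 ∧ e^W` for a normal variable `W` -/

lemma gaussianReal_real_Ioi_neg (a : ℝ) : (gaussianReal 0 1).real (Set.Ioi (-a)) = Phi a := by
  have h : (gaussianReal 0 1).map (fun x => -x) = gaussianReal 0 1 := by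
    rw [gaussianReal_map_neg, neg_zero]
  have hna : NullSingletonClass (gaussianReal 0 1) :=
    nullSingletonClass_gaussianReal one_ne_zero
  rw [Phi, cdf_eq_real, measureReal_def, measureReal_def]
  conv_lhs => rw [← h]
  rw [Measure.map_apply (by fun_prop) measurableSet_Ioi]
  have : (fun x : ℝ => -x) ⁻¹' Set.Ioi (-a) = Set.Iio a := by ext; simp
  rw [this, measure_congr Iio_ae_eq_Iic]

lemma integral_min_one_exp_gaussian (μ σ : ℝ) (hσ : 0 < σ) :
    ∫ y, min 1 (Real.exp (μ + σ * y)) ∂(gaussianReal 0 1) =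
      Phi (μ / σ) + Real.exp (μ + σ ^ 2 / 2) * Phi (-σ - μ / σ) := by
  set a := μ / σ with ha
  have hμ : μ = σ * a := by rw [ha]; field_simp
  have hint : Integrable (fun y => min 1 (Real.exp (μ + σ * y))) (gaussianReal 0 1) := by
    refine Integrable.of_bound (by fun_prop) 1 (Eventually.of_forall fun y => ?_)
    rw [Real.norm_eq_abs, abs_of_nonneg (le_min zero_le_one (Real.exp_nonneg _))]
    exact min_le_left _ _
  rw [← integral_add_compl (measurableSet_Ioi (a := -a)) hint, Set.compl_Ioi]
  congr 1
  · rw [← gaussianReal_real_Ioi_neg, setIntegral_congr_fun (g := fun _ => (1 : ℝ))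
      measurableSet_Ioi]
    · simp
    · intro y hy
      refine min_eq_left (Real.one_le_exp ?_)
      have : -a < y := hy
      rw [hμ]; nlinarith
  · rw [setIntegral_congr_fun (g := fun y => Real.exp (μ + σ * y)) measurableSet_Iic]
    · -- exponential tilting shifts the mean of the normal law by `σ`
      have hshift : gaussianReal σ 1 = (gaussianReal 0 1).map (· + σ) := by
        rw [gaussianReal_map_add_const, zero_add]
      have h1 : ∫ y in Set.Iic (-a), Real.exp (μ + σ * y) ∂(gaussianReal 0 1)
          = Real.exp (μ + σ ^ 2 / 2) * (gaussianReal σ 1).real (Set.Iic (-a)) := by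
        rw [gaussianReal_of_var_ne_zero 0 one_ne_zero,
          setIntegral_withDensity_eq_setIntegral_toReal_smul (by fun_prop)
            (Eventually.of_forall fun x => gaussianPDF_lt_top) _ measurableSet_Iic,
          measureReal_def, gaussianReal_apply_eq_integral _ one_ne_zero, ENNReal.toReal_ofReal,
          ← integral_const_mul]
        · congr 1; ext y
          simp only [toReal_gaussianPDF, gaussianPDFReal, smul_eq_mul]
          rw [mul_assoc, ← Real.exp_add, mul_left_comm, ← Real.exp_add]
          congr 2
          simp; ring
        · exact integral_nonneg fun x => gaussianPDFReal_nonneg _ _ _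
      rw [h1, Phi, cdf_eq_real, hshift, measureReal_def, measureReal_def,
        Measure.map_apply (by fun_prop) measurableSet_Iic]
      congr 3
      ext y
      simp only [Set.mem_preimage, Set.mem_Iic]
      constructor <;> intro h <;> linarith
    · intro y hy
      refine min_eq_right (Real.exp_le_one_iff.2 ?_)
      have : y ≤ -a := hy
      rw [hμ]; nlinarith

lemma Phi_zero : Phi 0 = 1 / 2 := by
  have h := gaussianReal_real_Ioi_neg 0
  have h2 : (gaussianReal 0 1).real (Set.Iic 0) = Phi 0 := by rw [Phi, cdf_eq_real]
  have h3 := measureReal_add_measureReal_compl (μ := gaussianReal 0 1)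
    (measurableSet_Ioi (a := (0 : ℝ)))
  rw [neg_zero] at h
  rw [Set.compl_Ioi, h2, h] at h3
  simp at h3
  linarith

/-! ### Matrices that are diagonal in a given orthonormal basis -/

section Diagonal

variable {d : ℕ}

lemma act_mul (B C : Matrix (Fin d) (Fin d) ℝ) (x : EuclideanSpace ℝ (Fin d)) :
    act (B * C) x = act B (act C x) := by simp [act]

lemma act_sub (B C : Matrix (Fin d) (Fin d) ℝ) (x : EuclideanSpace ℝ (Fin d)) :
    act (B - C) x = act B x - act C x := by simp [act]

lemma act_add (B C : Matrix (Fin d) (Fin d) ℝ) (x : EuclideanSpace ℝ (Fin d)) :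
    act (B + C) x = act B x + act C x := by simp [act]

lemma act_one (x : EuclideanSpace ℝ (Fin d)) : act 1 x = x := by simp [act]

lemma act_smul (B : Matrix (Fin d) (Fin d) ℝ) (c : ℝ) (x : EuclideanSpace ℝ (Fin d)) :
    act B (c • x) = c • act B x := by simp [act]

lemma inner_act_transpose (B : Matrix (Fin d) (Fin d) ℝ) (x y : EuclideanSpace ℝ (Fin d)) :
    inner ℝ x (act B.transpose y) = inner ℝ (act B x) y := by
  have h : Matrix.toEuclideanCLM (n := Fin d) (𝕜 := ℝ) B.transpose
      = ContinuousLinearMap.adjoint (Matrix.toEuclideanCLM (n := Fin d) (𝕜 := ℝ) B) := by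
    rw [← ContinuousLinearMap.star_eq_adjoint, ← map_star, Matrix.star_eq_conjTranspose,
      Matrix.conjTranspose_eq_transpose_of_trivial]
  unfold act
  rw [h, ContinuousLinearMap.adjoint_inner_right]

/-- `B` is diagonal in the orthonormal basis `q`, with eigenvalues `c`. The eigenvalues need not be
distinct, and their order is that of `q`. -/
def DiagIn (q : OrthonormalBasis (Fin d) ℝ (EuclideanSpace ℝ (Fin d)))
    (B : Matrix (Fin d) (Fin d) ℝ) (c : Fin d → ℝ) : Prop :=
  ∀ k, act B (q k) = c k • q k

variable {q : OrthonormalBasis (Fin d) ℝ (EuclideanSpace ℝ (Fin d))}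
  {B C : Matrix (Fin d) (Fin d) ℝ} {b c : Fin d → ℝ}

lemma DiagIn.mul (hB : DiagIn q B b) (hC : DiagIn q C c) :
    DiagIn q (B * C) (fun k => b k * c k) := fun k => by
  rw [act_mul, hC k, act_smul, hB k, smul_smul, mul_comm]

lemma DiagIn.sub (hB : DiagIn q B b) (hC : DiagIn q C c) :
    DiagIn q (B - C) (fun k => b k - c k) := fun k => by
  rw [act_sub, hC k, hB k, sub_smul]

lemma DiagIn.ne_zero (hB : DiagIn q B b) (hu : IsUnit B) (k : Fin d) : b k ≠ 0 := by
  intro h0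
  have h := hB k
  rw [h0, zero_smul] at h
  have h1 : act (B⁻¹ * B) (q k) = 0 := by rw [act_mul, h]; simp [act]
  rw [Matrix.nonsing_inv_mul _ ((Matrix.isUnit_iff_isUnit_det _).1 hu), act_one] at h1
  exact q.orthonormal.ne_zero k h1

lemma DiagIn.inv (hB : DiagIn q B b) (hu : IsUnit B) :
    DiagIn q B⁻¹ (fun k => (b k)⁻¹) := fun k => by
  have h1 : act (B⁻¹ * B) (q k) = q k := by
    rw [Matrix.nonsing_inv_mul _ ((Matrix.isUnit_iff_isUnit_det _).1 hu), act_one]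
  rw [act_mul, hB k, act_smul] at h1
  rw [eq_inv_smul_iff₀ (hB.ne_zero hu k), h1]

lemma DiagIn.inner_act (hB : DiagIn q B b) (k : Fin d) (x : EuclideanSpace ℝ (Fin d)) :
    inner ℝ (q k) (act B x) = b k * inner ℝ (q k) x := by
  conv_lhs => rw [← q.sum_repr' x]
  have : act B (∑ i, inner ℝ (q i) x • q i) = ∑ i, inner ℝ (q i) x • (b i • q i) := by
    rw [act, map_sum]
    refine Finset.sum_congr rfl fun i _ => ?_
    rw [map_smul]
    exact congrArg _ (hB i)
  rw [this, inner_sum]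
  simp only [inner_smul_right, q.inner_eq_ite]
  simp
  ring

/-- The eigenvalues are real and the basis is orthonormal, so `B` is symmetric. -/
lemma DiagIn.transpose (hB : DiagIn q B b) : DiagIn q B.transpose b := fun k => by
  refine InnerProductSpace.ext_inner_left_basis q.toBasis fun j => ?_
  simp only [OrthonormalBasis.coe_toBasis]
  rw [inner_act_transpose, hB j, inner_smul_left, inner_smul_right, q.inner_eq_ite]
  by_cases h : j = k
  · subst h; simp
  · simp [h]

lemma DiagIn.eig_eq (hB : DiagIn q B b) (k : Fin d) : inner ℝ (q k) (act B (q k)) = b k := by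
  rw [hB k, inner_smul_right, q.inner_eq_one, mul_one]

lemma DiagIn.inner_act_self (hB : DiagIn q B b) (x : EuclideanSpace ℝ (Fin d)) :
    inner ℝ x (act B x) = ∑ k, b k * inner ℝ (q k) x ^ 2 := by
  rw [← q.sum_inner_mul_inner x]
  refine Finset.sum_congr rfl fun k _ => ?_
  rw [hB.inner_act, real_inner_comm]
  ring

lemma dotProduct_mulVec_eq_inner_act (x : EuclideanSpace ℝ (Fin d)) :
    x.ofLp ⬝ᵥ B.mulVec x.ofLp = inner ℝ x (act B x) := by
  rw [act, Matrix.inner_toEuclideanCLM]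

lemma DiagIn.posDef (hB : DiagIn q B b) (hb : ∀ k, 0 < b k) : B.PosDef := by
  have hsymm : B.transpose = B := by
    apply (Matrix.toEuclideanCLM (n := Fin d) (𝕜 := ℝ)).injective
    refine ContinuousLinearMap.coe_injective (q.toBasis.ext fun k => ?_)
    exact (hB.transpose k).trans (hB k).symm
  refine Matrix.PosDef.of_dotProduct_mulVec_pos ?_ fun x hx => ?_
  · rw [Matrix.IsHermitian, Matrix.conjTranspose_eq_transpose_of_trivial, hsymm]
  · have h := dotProduct_mulVec_eq_inner_act (B := B) (WithLp.toLp 2 x)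
    simp only [star_trivial]
    refine lt_of_lt_of_eq ?_ h.symm
    rw [hB.inner_act_self]
    have hx' : WithLp.toLp 2 x ≠ 0 := by simpa using hx
    have hsum : 0 < ∑ k, inner ℝ (q k) (WithLp.toLp 2 x) ^ 2 := by
      rw [q.sum_sq_inner_right]
      have := norm_pos_iff.2 hx'
      positivity
    obtain ⟨k, -, hk⟩ := Finset.exists_ne_zero_of_sum_ne_zero hsum.ne'
    exact Finset.sum_pos' (fun j _ => mul_nonneg (hb j).le (sq_nonneg _))
      ⟨k, Finset.mem_univ _, mul_pos (hb k) (lt_of_le_of_ne (sq_nonneg _) hk.symm)⟩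

/-- A function of `A` is diagonal in every orthonormal eigenbasis of `A`: on the finite spectrum
it agrees with a polynomial. -/
lemma IsFunctionOf.diagIn {A : Matrix (Fin d) (Fin d) ℝ} (hA : A.IsHermitian)
    (h : IsFunctionOf B A) {a : Fin d → ℝ} (ha : DiagIn q A a) : ∃ b, DiagIn q B b := by
  obtain ⟨f, rfl⟩ := h
  have hsa : IsSelfAdjoint A := hA
  have hfin : (spectrum ℝ A).Finite := Matrix.finite_real_spectrum
  let p : Polynomial ℝ := Lagrange.interpolate hfin.toFinset id f
  have hp : cfc f A = Polynomial.aeval A p := by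
    rw [← cfc_polynomial p A hsa]
    refine cfc_congr fun x hx => ?_
    exact (Lagrange.eval_interpolate_at_node f (s := hfin.toFinset) (v := id)
      (Set.injOn_id _) (hfin.mem_toFinset.2 hx)).symm
  rw [hp]
  have hpoly : ∀ p : Polynomial ℝ, DiagIn q (Polynomial.aeval A p) (fun k => p.eval (a k)) := by
    intro p
    induction p using Polynomial.induction_on' with
    | add p r hp hr =>
      intro k
      change _ = (p + r).eval (a k) • q k
      rw [map_add, act_add, hp k, hr k, Polynomial.eval_add, add_smul]
    | monomial n r =>
      intro k
      change _ = (Polynomial.monomial n r).eval (a k) • q k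
      have hpow : act (A ^ n) (q k) = a k ^ n • q k := by
        induction n with
        | zero => simp [act_one]
        | succ n ih => rw [pow_succ, act_mul, ha k, act_smul, ih, smul_smul, pow_succ, mul_comm]
      rw [Polynomial.aeval_monomial, Algebra.algebraMap_eq_smul_one, smul_mul_assoc, one_mul,
        Polynomial.eval_monomial, mul_smul, ← hpow]
      simp [act]
  exact ⟨_, hpoly p⟩

/-- The coordinates of a normal vector along an eigenbasis of its covariance matrix, standardized,
are independent standard normal variables. -/
lemma DiagIn.map_multivariateGaussian {s : Fin d → ℝ} (hB : DiagIn q B (fun k => s k ^ 2))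
    (hs : ∀ k, 0 < s k) (m : EuclideanSpace ℝ (Fin d)) :
    (Measure.pi fun _ : Fin d => gaussianReal 0 1).map (fun ξ => m + ∑ k, (s k * ξ k) • q k)
      = multivariateGaussian m B := by
  have hpos : B.PosSemidef := (hB.posDef fun k => pow_pos (hs k) 2).posSemidef
  have hm : Measurable fun ξ : Fin d → ℝ => m + ∑ k, (s k * ξ k) • q k := by fun_prop
  have : IsProbabilityMeasure ((Measure.pi fun _ : Fin d => gaussianReal 0 1).map
    (fun ξ => m + ∑ k, (s k * ξ k) • q k)) := Measure.isProbabilityMeasure_map hm.aemeasurable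
  refine Measure.ext_of_charFun ?_
  ext t
  rw [charFun_multivariateGaussian hpos, dotProduct_mulVec_eq_inner_act, hB.inner_act_self,
    charFun_apply, integral_map hm.aemeasurable (by fun_prop)]
  have e : ∀ ξ : Fin d → ℝ, Complex.exp ((inner ℝ (m + ∑ k, (s k * ξ k) • q k) t : ℝ) * Complex.I)
      = Complex.exp ((inner ℝ t m : ℝ) * Complex.I) *
        ∏ k, Complex.exp ((s k * inner ℝ (q k) t : ℝ) * (ξ k : ℂ) * Complex.I) := by
    intro ξ
    rw [← Complex.exp_sum, ← Complex.exp_add, ← Finset.sum_mul, ← add_mul, inner_add_left,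
      sum_inner,
      real_inner_comm]
    congr 2
    push_cast
    congr 1
    refine Finset.sum_congr rfl fun k _ => ?_
    rw [real_inner_smul_left]
    push_cast
    ring
  simp_rw [e]
  rw [integral_const_mul,
    integral_fintype_prod_eq_prod
      (f := fun k (x : ℝ) => Complex.exp ((s k * inner ℝ (q k) t : ℝ) * (x : ℂ) * Complex.I))]
  simp_rw [← charFun_apply_real, charFun_gaussianReal]
  rw [← Complex.exp_sum, ← Complex.exp_add]
  congr 1
  rw [sub_eq_add_neg]
  congr 1
  push_cast
  rw [Finset.sum_div, ← Finset.sum_neg_distrib]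
  refine Finset.sum_congr rfl fun k _ => ?_
  simp
  ring

/-- The density of a normal law factorizes along an eigenbasis of its covariance matrix. -/
lemma gaussianDensity_eq {s : Fin d → ℝ} (hB : DiagIn q B (fun k => s k ^ 2))
    (hs : ∀ k, 0 < s k) (m x : EuclideanSpace ℝ (Fin d)) :
    gaussianDensity m B x = (Real.sqrt ((2 * Real.pi) ^ d * B.det))⁻¹ *
      Real.exp (∑ k, -(1 / 2) * ((inner ℝ (q k) x - inner ℝ (q k) m) ^ 2 / s k ^ 2)) := by
  have hpos := hB.posDef fun k => pow_pos (hs k) 2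
  rw [gaussianDensity, (hB.inv hpos.isUnit).inner_act_self, Finset.mul_sum]
  congr 2
  refine Finset.sum_congr rfl fun k _ => ?_
  rw [inner_sub_right, div_eq_inv_mul _ (s k ^ 2)]

end Diagonal

namespace SplittingMH

variable {d : ℕ} (P : SplittingMH d) (S : SpectralDecomp P.A)

/-! ### The algorithm in the eigenbasis of `A` -/

/-- The standard deviation of the proposal noise along `q_k`. -/
def noiseScale (k : Fin d) : ℝ := √(P.g S k / P.tlam2 S k)

variable {P}

/-- All matrices of the algorithm are diagonal in the eigenbasis. The eigenvalues of the proposal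
covariance are positive because `Mᵀ + N` is positive definite. -/
lemma Admissible.diag (hP : P.Admissible) :
    DiagIn S.q P.calA (P.tlam2 S) ∧ DiagIn S.q P.G (P.Gk S) ∧
      DiagIn S.q P.M⁻¹ (fun k => P.tg S k / P.tlam2 S k) ∧
      (∀ k, P.tlam2 S k ≠ 0) ∧ (∀ k, 0 < P.g S k / P.tlam2 S k) := by
  have hA : DiagIn S.q P.A (fun k => S.lam k ^ 2) := S.act_q
  have hH := hP.posDef_A.isHermitian
  obtain ⟨μ, hM⟩ := hP.function_M.diagIn hH hA
  obtain ⟨ν, hN⟩ := hP.function_N.diagIn hH hA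
  have hcalA : DiagIn S.q P.calA (fun k => μ k - ν k) := hM.sub hN
  have hMi := hM.inv hP.isUnit_M
  have hG : DiagIn S.q P.G (fun k => (μ k)⁻¹ * ν k) := hMi.mul hN
  have e1 : P.tlam2 S = fun k => μ k - ν k := funext fun k => hcalA.eig_eq k
  have e2 : P.Gk S = fun k => (μ k)⁻¹ * ν k := funext fun k => hG.eig_eq k
  have hμ := hM.ne_zero hP.isUnit_M
  have ht := hcalA.ne_zero hP.isUnit_calA
  have hpos : ∀ k, 0 < μ k + ν k := by
    intro k
    have h := hP.posDef_noise.dotProduct_mulVec_pos (x := (S.q k).ofLp)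
      (by simpa using S.q.orthonormal.ne_zero k)
    rw [star_trivial, dotProduct_mulVec_eq_inner_act, act_add, inner_add_right,
      hM.transpose.eig_eq, hN.eig_eq] at h
    exact h
  refine ⟨e1 ▸ hcalA, e2 ▸ hG, fun k => ?_, fun k => ?_, fun k => ?_⟩
  · change _ = (P.tg S k / P.tlam2 S k) • S.q k
    rw [hMi k, tg, e1, e2]
    congr 1
    have := ht k
    have := hμ k
    field_simp
  · rw [e1]; exact ht k
  · rw [g, e1, e2]
    have h3 := ht k
    have h4 := hμ k
    have : (1 - ((μ k)⁻¹ * ν k) ^ 2) / (μ k - ν k) = (μ k + ν k) / μ k ^ 2 := by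
      field_simp
      ring
    simp only [this]
    exact div_pos (hpos k) (by positivity)

lemma noiseScale_pos (hP : P.Admissible) (k : Fin d) : 0 < P.noiseScale S k :=
  Real.sqrt_pos.2 ((hP.diag S).2.2.2.2 k)

lemma noiseScale_sq (hP : P.Admissible) (k : Fin d) :
    P.noiseScale S k ^ 2 = P.g S k / P.tlam2 S k :=
  Real.sq_sqrt ((hP.diag S).2.2.2.2 k).le

lemma g_ne_zero (hP : P.Admissible) (k : Fin d) : P.g S k ≠ 0 := fun h => by
  have := (hP.diag S).2.2.2.2 k
  rw [h, zero_div] at this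
  exact this.false

lemma Admissible.diag_propCov (hP : P.Admissible) :
    DiagIn S.q P.propCov (fun k => P.noiseScale S k ^ 2) := by
  obtain ⟨hcalA, hG, -, ht, -⟩ := hP.diag S
  have hi := hcalA.inv hP.isUnit_calA
  intro k
  refine (hi.sub ((hG.mul hi).mul hG.transpose) k).trans ?_
  simp only [noiseScale_sq S hP, g]
  congr 1
  have := ht k
  field_simp

lemma Admissible.diag_targetCov (hP : P.Admissible) :
    DiagIn S.q P.A⁻¹ (fun k => (S.lam k)⁻¹ ^ 2) := by
  have hA : DiagIn S.q P.A (fun k => S.lam k ^ 2) := S.act_q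
  intro k
  rw [hA.inv hP.posDef_A.isUnit k]
  simp only [inv_pow]

lemma one_add_tr (hP : P.Admissible) (k : Fin d) :
    1 + P.tr S k = S.lam k ^ 2 / P.tlam2 S k := by
  have := (hP.diag S).2.2.2.1 k
  rw [tr, lam2]
  field_simp
  ring

lemma root_eq (hP : P.Admissible) (k : Fin d) : P.root S k = S.lam k * P.noiseScale S k := by
  rw [root, one_add_tr S hP, noiseScale, mul_div_left_comm, Real.sqrt_mul (sq_nonneg _),
    Real.sqrt_sq (S.lam_pos k).le]

variable (P)

/-- The state with standardized coordinates `ξ`. -/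
def stateOf (ξ : Fin d → ℝ) : EuclideanSpace ℝ (Fin d) :=
  act P.A⁻¹ P.b + ∑ k, ((S.lam k)⁻¹ * ξ k) • S.q k

/-- The proposal noise with standardized coordinates `η`; the leading `0` is its mean. -/
def noiseOf (η : Fin d → ℝ) : EuclideanSpace ℝ (Fin d) :=
  0 + ∑ k, (P.noiseScale S k * η k) • S.q k

/-- The proposed displacement along `q_k`, as a function of the standardized coordinates. -/
def incr (k : Fin d) (p : ℝ × ℝ) : ℝ :=
  -P.tg S k * (P.hr S k + p.1 / S.lam k) + P.noiseScale S k * p.2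

/-- The contribution of the `k`-th coordinate to the logarithm of the acceptance ratio. -/
def logTerm (k : Fin d) (p : ℝ × ℝ) : ℝ := P.mu S k + chaos (fun j => P.T S j.succ k) p

@[fun_prop]
lemma continuous_logTerm (k : Fin d) : Continuous (P.logTerm S k) := by
  unfold logTerm; fun_prop

@[fun_prop]
lemma continuous_incr (k : Fin d) : Continuous (P.incr S k) := by
  unfold incr; fun_prop

lemma chaosVar_T (k : Fin d) : chaosVar (fun j => P.T S j.succ k) = P.sigma2 S k := by
  simp [chaosVar, sigma2]

lemma logTerm_eq (k : Fin d) (p : ℝ × ℝ) :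
    P.logTerm S k p = P.T S 0 k + P.T S 1 k * p.1 + P.T S 2 k * p.2 + P.T S 3 k * p.1 ^ 2
      + P.T S 4 k * p.2 ^ 2 + P.T S 5 k * (p.1 * p.2) := by
  simp only [logTerm, chaos, mu, Fin.isValue, Fin.succ_zero_eq_one, Fin.succ_one_eq_two,
    show (2 : Fin 5).succ = (3 : Fin 6) from rfl, show (3 : Fin 5).succ = (4 : Fin 6) from rfl,
    show (4 : Fin 5).succ = (5 : Fin 6) from rfl]
  ring

variable {P}

lemma inner_stateOf (ξ : Fin d → ℝ) (k : Fin d) :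
    inner ℝ (S.q k) (P.stateOf S ξ) = P.m S k + ξ k / S.lam k := by
  rw [stateOf, inner_add_right, inner_sum]
  simp only [inner_smul_right, S.q.inner_eq_ite]
  simp [m, div_eq_inv_mul]

lemma inner_noiseOf (η : Fin d → ℝ) (k : Fin d) :
    inner ℝ (S.q k) (P.noiseOf S η) = P.noiseScale S k * η k := by
  rw [noiseOf, zero_add, inner_sum]
  simp only [inner_smul_right, S.q.inner_eq_ite]
  simp

lemma inner_propMean (hP : P.Admissible) (x : EuclideanSpace ℝ (Fin d)) (k : Fin d) :
    inner ℝ (S.q k) (P.propMean x) =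
      P.Gk S k * inner ℝ (S.q k) x + P.tg S k * P.tm S k := by
  obtain ⟨hcalA, hG, hMi, -, -⟩ := hP.diag S
  rw [propMean, inner_add_right, hG.inner_act, hMi.inner_act, tm,
    (hcalA.inv hP.isUnit_calA).inner_act, div_eq_mul_inv, mul_assoc]

/-- The proposal kernel is reversible with respect to the (formal) normal law with mean `𝒜⁻¹ β` and
precision `𝒜`; this removes the noise variance from the quotient of proposal densities. -/
lemma logRatio_coordinate (hP : P.Admissible) (k : Fin d) (ξ η : ℝ) {x y : ℝ}
    (hx : x = P.m S k + ξ / S.lam k)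
    (hy : y = P.Gk S k * x + P.tg S k * P.tm S k + P.noiseScale S k * η) :
    -(1 / 2) * ((y - P.m S k) ^ 2 / (S.lam k)⁻¹ ^ 2)
      + -(1 / 2) * ((x - (P.Gk S k * y + P.tg S k * P.tm S k)) ^ 2 / P.noiseScale S k ^ 2)
      - (-(1 / 2) * ((x - P.m S k) ^ 2 / (S.lam k)⁻¹ ^ 2)
      + -(1 / 2) * ((y - (P.Gk S k * x + P.tg S k * P.tm S k)) ^ 2 / P.noiseScale S k ^ 2))
      = P.logTerm S k (ξ, η) := by
  have hl := (S.lam_pos k).ne'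
  have ht := (hP.diag S).2.2.2.1 k
  have hg := g_ne_zero S hP k
  have hrev : (x - (P.Gk S k * y + P.tg S k * P.tm S k)) ^ 2 / P.noiseScale S k ^ 2
      - (y - (P.Gk S k * x + P.tg S k * P.tm S k)) ^ 2 / P.noiseScale S k ^ 2
      = P.tlam2 S k * ((x - P.tm S k) ^ 2 - (y - P.tm S k) ^ 2) := by
    rw [noiseScale_sq S hP]
    field_simp
    rw [g, tg]
    ring
  have hmain : -(1 / 2) * ((y - P.m S k) ^ 2 * S.lam k ^ 2 - (x - P.m S k) ^ 2 * S.lam k ^ 2)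
      - 1 / 2 * (P.tlam2 S k * ((x - P.tm S k) ^ 2 - (y - P.tm S k) ^ 2))
      = P.logTerm S k (ξ, η) := by
    have hT4 : P.T S 4 k = -(1 / 2) * P.r S k * (P.noiseScale S k ^ 2 * S.lam k ^ 2) := by
      rw [noiseScale_sq S hP]
      simp only [T, Matrix.cons_val, one_add_tr S hP]
      ring
    rw [logTerm_eq, hT4]
    simp only [T, Matrix.cons_val, Matrix.cons_val_zero, Matrix.cons_val_one, root_eq S hP, r,
      lam2, g, hr]
    rw [hy, hx, tg]
    field_simp
    ring
  rw [← hmain, ← hrev]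
  simp only [inv_pow, div_inv_eq_mul]
  ring

/-- In standardized coordinates the log-acceptance ratio is a sum of independent terms. -/
lemma accept_eq (hP : P.Admissible) (ω : Fin d → ℝ × ℝ) :
    P.accept (P.stateOf S fun k => (ω k).1)
        (P.propMean (P.stateOf S fun k => (ω k).1) + P.noiseOf S fun k => (ω k).2)
      = min 1 (Real.exp (∑ k, P.logTerm S k (ω k))) := by
  set x := P.stateOf S fun k => (ω k).1 with hx
  set y := P.propMean x + P.noiseOf S fun k => (ω k).2 with hy
  have hsA : ∀ k, 0 < (S.lam k)⁻¹ := fun k => inv_pos.2 (S.lam_pos k)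
  have hdA := hP.diag_targetCov S
  have hdC := hP.diag_propCov S
  have hsC := noiseScale_pos S hP
  have hcA : (Real.sqrt ((2 * Real.pi) ^ d * (P.A⁻¹).det))⁻¹ ≠ 0 := by
    have := (hdA.posDef fun k => pow_pos (hsA k) 2).det_pos
    positivity
  have hcC : (Real.sqrt ((2 * Real.pi) ^ d * P.propCov.det))⁻¹ ≠ 0 := by
    have := (hdC.posDef fun k => pow_pos (hsC k) 2).det_pos
    positivity
  rw [accept, targetDensity, targetDensity, propDensity, propDensity,
    gaussianDensity_eq hdA hsA, gaussianDensity_eq hdA hsA, gaussianDensity_eq hdC hsC,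
    gaussianDensity_eq hdC hsC]
  congr 1
  have hcancel : ∀ {a c : ℝ}, a ≠ 0 → c ≠ 0 → ∀ e₁ e₂ e₃ e₄ : ℝ,
      a * e₁ * (c * e₂) / (a * e₃ * (c * e₄)) = e₁ * e₂ / (e₃ * e₄) := by
    intro a c ha hc e₁ e₂ e₃ e₄
    rw [mul_mul_mul_comm a, mul_mul_mul_comm a e₃, mul_div_mul_left _ _ (mul_ne_zero ha hc)]
  rw [hcancel hcA hcC, ← Real.exp_add, ← Real.exp_add, ← Real.exp_sub, ← Finset.sum_add_distrib,
    ← Finset.sum_add_distrib, ← Finset.sum_sub_distrib]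
  congr 1
  refine Finset.sum_congr rfl fun k _ => ?_
  simp only [inner_propMean S hP]
  refine logRatio_coordinate S hP k _ _ (inner_stateOf S _ k) ?_
  rw [hy, inner_add_right, inner_propMean S hP, inner_noiseOf]

lemma inner_proposal_sub (hP : P.Admissible) (ω : Fin d → ℝ × ℝ) (k : Fin d) :
    inner ℝ (S.q k) (P.propMean (P.stateOf S fun k => (ω k).1) + (P.noiseOf S fun k => (ω k).2)
      - P.stateOf S fun k => (ω k).1) = P.incr S k (ω k) := by
  rw [inner_sub_right, inner_add_right, inner_propMean S hP, inner_noiseOf, inner_stateOf, incr, hr,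
    tg]
  ring

lemma sqJump_eq (hP : P.Admissible) (i : Fin d) (ω : Fin d → ℝ × ℝ) (u : ℝ) :
    P.sqJump (S.q i) (P.stateOf S fun k => (ω k).1, P.noiseOf S fun k => (ω k).2, u)
      = if u < min 1 (Real.exp (∑ k, P.logTerm S k (ω k))) then P.incr S i (ω i) ^ 2 else 0 := by
  rw [sqJump, next, accept_eq S hP]
  split_ifs with h
  · simp only [inner_proposal_sub S hP]
  · simp

/-- The equilibrium law of the step is the image of standardized coordinates: independent Gaussian
pairs `(ξ_k, η_k)` and the uniform variable. -/
lemma measurePreserving_stepLaw (hP : P.Admissible) :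
    MeasurePreserving (fun w : (Fin d → ℝ × ℝ) × ℝ =>
        (P.stateOf S fun k => (w.1 k).1, P.noiseOf S fun k => (w.1 k).2, w.2))
      ((Measure.pi fun _ => gaussianPair).prod (volume.restrict (Set.Icc (0 : ℝ) 1)))
      P.stepLaw := by
  have h1 : MeasurePreserving (P.stateOf S) (Measure.pi fun _ => gaussianReal 0 1) P.target :=
    ⟨by unfold stateOf; fun_prop,
      (hP.diag_targetCov S).map_multivariateGaussian (fun k => inv_pos.2 (S.lam_pos k)) _⟩
  have h2 : MeasurePreserving (P.noiseOf S) (Measure.pi fun _ => gaussianReal 0 1)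
      (multivariateGaussian 0 P.propCov) :=
    ⟨by unfold noiseOf; fun_prop,
      (hP.diag_propCov S).map_multivariateGaussian (noiseScale_pos S hP) _⟩
  have h3 := measurePreserving_arrowProdEquivProdArrow ℝ ℝ (Fin d)
    (fun _ => gaussianReal 0 1) (fun _ => gaussianReal 0 1)
  have hid := MeasurePreserving.id (volume.restrict (Set.Icc (0 : ℝ) 1))
  have h4 := measurePreserving_prodAssoc (Measure.pi fun _ : Fin d => gaussianReal 0 1)
    (Measure.pi fun _ : Fin d => gaussianReal 0 1) (volume.restrict (Set.Icc (0 : ℝ) 1))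
  have h1' : IsProbabilityMeasure P.target := by unfold target; infer_instance
  exact (h1.prod (h2.prod hid)).comp (h4.comp (h3.prod hid))

lemma measurable_sqJump (q : EuclideanSpace ℝ (Fin d)) : Measurable (P.sqJump q) := by
  have hact : ∀ B : Matrix (Fin d) (Fin d) ℝ, Continuous (act B) := fun B => by
    unfold act; exact ContinuousLinearMap.continuous _
  have hM : Continuous P.propMean := by
    unfold propMean; exact ((hact _).comp continuous_id).add continuous_const
  have hY : Measurable fun w : EuclideanSpace ℝ (Fin d) × EuclideanSpace ℝ (Fin d) × ℝ =>
      P.propMean w.1 + w.2.1 := by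
    exact (hM.measurable.comp measurable_fst).add (by fun_prop)
  have hdens : ∀ (B : Matrix (Fin d) (Fin d) ℝ)
      (f g : EuclideanSpace ℝ (Fin d) × EuclideanSpace ℝ (Fin d) × ℝ → EuclideanSpace ℝ (Fin d)),
      Measurable f → Measurable g → Measurable fun w => gaussianDensity (f w) B (g w) := by
    intro B f g hf hg
    unfold gaussianDensity
    have : Measurable fun w => act B⁻¹ (g w - f w) := (hact _).measurable.comp (hg.sub hf)
    exact ((((hg.sub hf).inner this).const_mul _).exp).const_mul _
  have hacc : Measurable fun w : EuclideanSpace ℝ (Fin d) × EuclideanSpace ℝ (Fin d) × ℝ =>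
      P.accept w.1 (P.propMean w.1 + w.2.1) := by
    unfold accept targetDensity propDensity
    refine measurable_const.min (Measurable.div (Measurable.mul ?_ ?_) (Measurable.mul ?_ ?_))
    · exact hdens _ _ _ measurable_const hY
    · exact hdens _ _ _ (hM.measurable.comp hY) measurable_fst
    · exact hdens _ _ _ measurable_const measurable_fst
    · exact hdens _ _ _ (hM.measurable.comp measurable_fst) hY
  have hnext : Measurable fun w : EuclideanSpace ℝ (Fin d) × EuclideanSpace ℝ (Fin d) × ℝ =>
      P.next w.1 w.2.1 w.2.2 := by
    unfold next
    exact Measurable.ite (measurableSet_lt (by fun_prop) hacc) hY measurable_fst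
  unfold sqJump
  exact ((measurable_const.inner (hnext.sub measurable_fst)).pow_const 2)

end SplittingMH

lemma setIntegral_Icc_ite_lt {a : ℝ} (h0 : 0 ≤ a) (h1 : a ≤ 1) (c : ℝ) :
    ∫ u in Set.Icc (0 : ℝ) 1, (if u < a then c else 0) = c * a := by
  have : (fun u : ℝ => if u < a then c else 0) = (Set.Iio a).indicator fun _ => c := by
    ext u; simp [Set.indicator]
  rw [this, setIntegral_indicator measurableSet_Iio]
  have h2 : Set.Icc (0 : ℝ) 1 ∩ Set.Iio a = Set.Ico 0 a := by
    ext u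
    simp only [Set.mem_inter_iff, Set.mem_Icc, Set.mem_Iio, Set.mem_Ico]
    constructor
    · rintro ⟨⟨h, -⟩, h'⟩; exact ⟨h, h'⟩
    · rintro ⟨h, h'⟩; exact ⟨⟨h, (h'.le.trans h1)⟩, h'⟩
  rw [h2]
  simp [h0, mul_comm]

namespace SplittingMH

variable {d : ℕ} {P : SplittingMH d} (S : SpectralDecomp P.A)

/-- The second and fourth moments of the proposed displacement along `q_k`. -/
lemma incr_moments (hP : P.Admissible) (k : Fin d) :
    (Integrable (fun p => P.incr S k p ^ 2) gaussianPair ∧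
      ∫ p, P.incr S k p ^ 2 ∂gaussianPair = P.U1 S k) ∧
    (Integrable (fun p => P.incr S k p ^ 4) gaussianPair ∧
      ∫ p, P.incr S k p ^ 4 ∂gaussianPair = P.tg S k ^ 4 * P.hr S k ^ 4
      + 3 * (P.tg S k ^ 4 / P.lam2 S k ^ 2)
      + 3 * (P.g S k ^ 2 / P.tlam2 S k ^ 2)
      + 6 * (P.tg S k ^ 4 * P.hr S k ^ 2 / P.lam2 S k)
      + 6 * (P.tg S k ^ 2 * P.g S k * P.hr S k ^ 2 / P.tlam2 S k)
      + 6 * (P.tg S k ^ 2 * P.g S k / (P.lam2 S k * P.tlam2 S k))) := by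
  set a := -P.tg S k * P.hr S k with ha
  set b := -P.tg S k / S.lam k with hb
  set c := P.noiseScale S k with hc
  have hi : ∀ p : ℝ × ℝ, P.incr S k p = a + b * p.1 + c * p.2 := by
    intro p; rw [incr, ha, hb]; ring
  have hc2 : c ^ 2 = P.g S k / P.tlam2 S k := noiseScale_sq S hP k
  have hb2 : b ^ 2 = P.tg S k ^ 2 / P.lam2 S k := by rw [hb, lam2, div_pow, neg_sq]
  have ha2 : a ^ 2 = P.tg S k ^ 2 * P.hr S k ^ 2 := by rw [ha]; ring
  have h2 := integral_polynomial_gaussianPair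
    ![![a ^ 2, 2 * a * c, c ^ 2, 0, 0], ![2 * a * b, 2 * b * c, 0, 0, 0],
      ![b ^ 2, 0, 0, 0, 0], 0, 0] (fun p => P.incr S k p ^ 2)
    (fun p => by rw [hi]; simp [Fin.sum_univ_five]; ring)
  have h4 := integral_polynomial_gaussianPair
    ![![a ^ 4, 4 * a ^ 3 * c, 6 * a ^ 2 * c ^ 2, 4 * a * c ^ 3, c ^ 4],
      ![4 * a ^ 3 * b, 12 * a ^ 2 * b * c, 12 * a * b * c ^ 2, 4 * b * c ^ 3, 0],
      ![6 * a ^ 2 * b ^ 2, 12 * a * b ^ 2 * c, 6 * b ^ 2 * c ^ 2, 0, 0],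
      ![4 * a * b ^ 3, 4 * b ^ 3 * c, 0, 0, 0],
      ![b ^ 4, 0, 0, 0, 0]] (fun p => P.incr S k p ^ 4)
    (fun p => by rw [hi]; simp [Fin.sum_univ_five]; ring)
  refine ⟨⟨h2.1, h2.2.trans ?_⟩, h4.1, h4.2.trans ?_⟩
  · simp [U1, ha2, hb2, hc2]
    ring
  · have e4 : ∀ z : ℝ, z ^ 4 = (z ^ 2) ^ 2 := fun z => by ring
    have ht := (hP.diag S).2.2.2.1 k
    have hl : P.lam2 S k ≠ 0 := pow_ne_zero 2 (S.lam_pos k).ne'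
    simp [e4 a, e4 b, e4 c, ha2, hb2, hc2]
    field_simp
    ring

lemma integrable_sqJump_and_expSqJump (hP : P.Admissible) (i : Fin d) :
    Integrable (P.sqJump (S.q i)) P.stepLaw ∧
    P.expSqJump (S.q i) = ∫ ω, P.incr S i (ω i) ^ 2 *
      min 1 (Real.exp (∑ k, P.logTerm S k (ω k))) ∂(Measure.pi fun _ => gaussianPair) := by
  have hmp := measurePreserving_stepLaw S hP
  have hJ : AEStronglyMeasurable (P.sqJump (S.q i)) P.stepLaw :=
    (measurable_sqJump _).aestronglyMeasurable
  set J : (Fin d → ℝ × ℝ) × ℝ → ℝ := fun w =>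
    if w.2 < min 1 (Real.exp (∑ k, P.logTerm S k (w.1 k))) then P.incr S i (w.1 i) ^ 2 else 0
    with hJdef
  have hcomp : (P.sqJump (S.q i)) ∘ (fun w : (Fin d → ℝ × ℝ) × ℝ =>
        (P.stateOf S fun k => (w.1 k).1, P.noiseOf S fun k => (w.1 k).2, w.2)) = J :=
    funext fun w => sqJump_eq S hP i w.1 w.2
  have hmeas : Measurable J := by
    rw [← hcomp]; exact (measurable_sqJump _).comp hmp.measurable
  have hD : Integrable (fun ω : Fin d → ℝ × ℝ => P.incr S i (ω i) ^ 2)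
      (Measure.pi fun _ => gaussianPair) :=
    (measurePreserving_eval (fun _ : Fin d => gaussianPair) i).integrable_comp_of_integrable
      (incr_moments S hP i).1.1
  have hint : Integrable J
      ((Measure.pi fun _ => gaussianPair).prod (volume.restrict (Set.Icc (0 : ℝ) 1))) := by
    refine Integrable.mono' (hD.comp_fst (volume.restrict (Set.Icc (0 : ℝ) 1)))
      hmeas.aestronglyMeasurable (Eventually.of_forall fun w => ?_)
    rw [hJdef]
    dsimp only
    split_ifs
    · rw [Real.norm_eq_abs, abs_of_nonneg (sq_nonneg _)]
    · simpa using sq_nonneg _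
  refine ⟨(hmp.integrable_comp hJ).1 (by rw [hcomp]; exact hint), ?_⟩
  rw [expSqJump, ← hmp.map_eq, integral_map hmp.measurable.aemeasurable (by rwa [hmp.map_eq])]
  change ∫ w, ((P.sqJump (S.q i)) ∘ (fun w : (Fin d → ℝ × ℝ) × ℝ =>
        (P.stateOf S fun k => (w.1 k).1, P.noiseOf S fun k => (w.1 k).2, w.2))) w ∂_ = _
  rw [hcomp, integral_prod _ hint]
  refine integral_congr_ae (Eventually.of_forall fun ω => ?_)
  simp only [hJdef]
  rw [setIntegral_Icc_ite_lt (le_min zero_le_one (Real.exp_nonneg _)) (min_le_left _ _)]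

end SplittingMH

/-! ### Separating one coordinate from the acceptance probability -/

lemma min_one_exp_mem (x : ℝ) : 0 ≤ min 1 (Real.exp x) ∧ min 1 (Real.exp x) ≤ 1 :=
  ⟨le_min zero_le_one (Real.exp_nonneg _), min_le_left _ _⟩

lemma abs_min_one_exp_sub_le (x y : ℝ) :
    |min 1 (Real.exp x) - min 1 (Real.exp y)| ≤ |x - y| := by
  have key : ∀ x y : ℝ, x ≤ y → min 1 (Real.exp y) - min 1 (Real.exp x) ≤ y - x := by
    intro x y hxy
    rcases le_total 0 x with hx | hx
    · rw [min_eq_left (Real.one_le_exp hx)]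
      linarith [(min_one_exp_mem y).2]
    · rw [min_eq_right (Real.exp_le_one_iff.2 hx)]
      have h1 : min 1 (Real.exp y) * (1 - (y - x)) ≤ Real.exp x := by
        rcases le_total 0 (1 - (y - x)) with h | h
        · have h2 : Real.exp x = Real.exp y * Real.exp (-(y - x)) := by
            rw [← Real.exp_add]; congr 1; ring
          rw [h2]
          refine mul_le_mul (min_le_right _ _) ?_ h (Real.exp_nonneg _)
          linarith [Real.add_one_le_exp (-(y - x))]
        · exact (mul_nonpos_of_nonneg_of_nonpos (min_one_exp_mem y).1 h).trans (Real.exp_nonneg _)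
      nlinarith [(min_one_exp_mem y).2, (min_one_exp_mem y).1]
  have mono : ∀ x y : ℝ, x ≤ y → min 1 (Real.exp x) ≤ min 1 (Real.exp y) := fun x y h =>
    min_le_min_left _ (Real.exp_le_exp.2 h)
  rcases le_total x y with h | h
  · rw [abs_sub_comm, abs_sub_comm x, abs_of_nonneg (sub_nonneg.2 h),
      abs_of_nonneg (sub_nonneg.2 (mono _ _ h))]
    exact key x y h
  · rw [abs_of_nonneg (sub_nonneg.2 h), abs_of_nonneg (sub_nonneg.2 (mono _ _ h))]
    exact key y x h

/-- The Cauchy-Schwarz inequality for integrals. -/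
lemma integral_abs_mul_abs_le {Ω : Type*} [MeasurableSpace Ω] {Q : Measure Ω} {f g : Ω → ℝ}
    (hf : AEStronglyMeasurable f Q) (hg : AEStronglyMeasurable g Q)
    (hf2 : Integrable (fun x => f x ^ 2) Q) (hg2 : Integrable (fun x => g x ^ 2) Q) :
    Integrable (fun x => |f x| * |g x|) Q ∧
      ∫ x, |f x| * |g x| ∂Q ≤ √(∫ x, f x ^ 2 ∂Q) * √(∫ x, g x ^ 2 ∂Q) := by
  have hf' : MemLp (fun x => |f x|) 2 Q := ((memLp_two_iff_integrable_sq hf).2 hf2).abs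
  have hg' : MemLp (fun x => |g x|) 2 Q := ((memLp_two_iff_integrable_sq hg).2 hg2).abs
  refine ⟨hf'.integrable_mul hg', ?_⟩
  have h := integral_mul_le_Lp_mul_Lq_of_nonneg (μ := Q) (f := fun x => |f x|) (g := fun x => |g x|)
    Real.HolderConjugate.two_two (Eventually.of_forall fun x => abs_nonneg _)
    (Eventually.of_forall fun x => abs_nonneg _) (by simpa using hf') (by simpa using hg')
  simp only [Real.rpow_two, sq_abs] at h
  rw [Real.sqrt_eq_rpow, Real.sqrt_eq_rpow]
  exact h

namespace SplittingMH

variable {d : ℕ} (P : SplittingMH d) (S : SpectralDecomp P.A)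

/-- The expected acceptance probability when the contribution of the `i`-th coordinate to the
log-acceptance ratio is left out. -/
def restAccept (i : Fin d) : ℝ :=
  ∫ ω : Fin d → ℝ × ℝ, min 1 (Real.exp (∑ k ∈ Finset.univ.erase i, P.logTerm S k (ω k)))
    ∂(Measure.pi fun _ => gaussianPair)

variable {P}

/-- The proposed displacement along `q_i` is independent of the other coordinates. -/
lemma integral_incr_sq_mul_rest (hP : P.Admissible) (i : Fin d) :
    ∫ ω : Fin d → ℝ × ℝ, P.incr S i (ω i) ^ 2 *
        min 1 (Real.exp (∑ k ∈ Finset.univ.erase i, P.logTerm S k (ω k)))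
      ∂(Measure.pi fun _ => gaussianPair) = P.U1 S i * P.restAccept S i := by
  have hind : iIndepFun (fun k (ω : Fin d → ℝ × ℝ) => ω k) (Measure.pi fun _ => gaussianPair) :=
    iIndepFun_pi (X := fun _ => id) fun _ => aemeasurable_id
  have h2 := (hind.indepFun_finset {i} (Finset.univ.erase i) (by simp)
    (fun k => measurable_pi_apply k)).comp
    (φ := fun f : ↥({i} : Finset (Fin d)) → ℝ × ℝ =>
      P.incr S i (f ⟨i, Finset.mem_singleton_self i⟩) ^ 2)
    (ψ := fun f : ↥(Finset.univ.erase i) → ℝ × ℝ =>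
      min 1 (Real.exp (∑ k : ↥(Finset.univ.erase i), P.logTerm S k (f k))))
    (by fun_prop) (by fun_prop)
  have h3 : IndepFun (fun ω : Fin d → ℝ × ℝ => P.incr S i (ω i) ^ 2)
      (fun ω => min 1 (Real.exp (∑ k ∈ Finset.univ.erase i, P.logTerm S k (ω k))))
      (Measure.pi fun _ => gaussianPair) := by
    have e : (fun ω : Fin d → ℝ × ℝ =>
          min 1 (Real.exp (∑ k ∈ Finset.univ.erase i, P.logTerm S k (ω k))))
        = fun ω => min 1 (Real.exp (∑ k : ↥(Finset.univ.erase i), P.logTerm S k (ω k))) := by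
      ext ω
      rw [Finset.sum_coe_sort (Finset.univ.erase i) (fun k => P.logTerm S k (ω k))]
    rw [e]
    exact h2
  rw [h3.integral_fun_mul_eq_mul_integral (Measurable.aestronglyMeasurable (by fun_prop))
    (Measurable.aestronglyMeasurable (by fun_prop)), restAccept]
  congr 1
  rw [← (incr_moments S hP i).1.2]
  have hmp := measurePreserving_eval (fun _ : Fin d => gaussianPair) i
  conv_rhs => rw [← hmp.map_eq]
  rw [integral_map hmp.measurable.aemeasurable (by fun_prop)]

/-- Leaving out the `i`-th coordinate from the acceptance probability costs at most the bound on
`U₃`, because `z ↦ 1 ∧ e^z` is `1`-Lipschitz. -/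
lemma abs_expSqJump_sub_le (hP : P.Admissible) (i : Fin d) :
    |P.expSqJump (S.q i) - P.U1 S i * P.restAccept S i| ≤ P.U3bound S i := by
  obtain ⟨⟨hi2, -⟩, hi4, e4⟩ := incr_moments S hP i
  have hmp := measurePreserving_eval (fun _ : Fin d => gaussianPair) i
  have hD : Integrable (fun ω : Fin d → ℝ × ℝ => P.incr S i (ω i) ^ 2)
      (Measure.pi fun _ => gaussianPair) := hmp.integrable_comp_of_integrable hi2
  have hbdd : ∀ s : Finset (Fin d), Integrable (fun ω : Fin d → ℝ × ℝ => P.incr S i (ω i) ^ 2 *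
      min 1 (Real.exp (∑ k ∈ s, P.logTerm S k (ω k)))) (Measure.pi fun _ => gaussianPair) := by
    intro s
    refine hD.mono' (by fun_prop) (Eventually.of_forall fun ω => ?_)
    rw [Real.norm_eq_abs, abs_mul, abs_of_nonneg (sq_nonneg _), abs_of_nonneg (min_one_exp_mem _).1]
    exact mul_le_of_le_one_right (sq_nonneg _) (min_one_exp_mem _).2
  rw [(integrable_sqJump_and_expSqJump S hP i).2, ← integral_incr_sq_mul_rest S hP,
    ← integral_sub (hbdd _) (hbdd _)]
  obtain ⟨hl2, el2⟩ := chaos_second_moment (fun j => P.T S j.succ i) (P.mu S i)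
  have hD4 : Integrable (fun p => (P.incr S i p ^ 2) ^ 2) gaussianPair := by
    simpa only [← pow_mul] using hi4
  obtain ⟨hCSi, hCS⟩ := integral_abs_mul_abs_le (Q := gaussianPair) (f := P.logTerm S i)
    (g := fun p => P.incr S i p ^ 2) (by fun_prop) (by fun_prop) hl2 hD4
  have hcs2 : ∫ ω : Fin d → ℝ × ℝ, |P.logTerm S i (ω i)| * |P.incr S i (ω i) ^ 2|
      ∂(Measure.pi fun _ => gaussianPair)
      = ∫ p, |P.logTerm S i p| * |P.incr S i p ^ 2| ∂gaussianPair := by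
    conv_rhs => rw [← hmp.map_eq]
    rw [integral_map hmp.measurable.aemeasurable (by fun_prop)]
  have hCSi' : Integrable (fun ω : Fin d → ℝ × ℝ => |P.logTerm S i (ω i)| * |P.incr S i (ω i) ^ 2|)
      (Measure.pi fun _ => gaussianPair) := hmp.integrable_comp_of_integrable hCSi
  rw [← Real.norm_eq_abs]
  calc _ ≤ ∫ ω : Fin d → ℝ × ℝ, |P.logTerm S i (ω i)| * |P.incr S i (ω i) ^ 2|
        ∂(Measure.pi fun _ => gaussianPair) := by
        refine norm_integral_le_of_norm_le hCSi'
          (Eventually.of_forall fun ω => ?_)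
        rw [← mul_sub, Real.norm_eq_abs, abs_mul, mul_comm]
        refine mul_le_mul_of_nonneg_right ?_ (abs_nonneg _)
        refine (abs_min_one_exp_sub_le _ _).trans (le_of_eq ?_)
        rw [← Finset.add_sum_erase _ _ (Finset.mem_univ i), add_sub_cancel_right]
    _ ≤ _ := by
        rw [hcs2]
        refine hCS.trans (le_of_eq ?_)
        rw [U3bound, ← e4]
        simp only [← pow_mul]
        have : ∫ p, P.logTerm S i p ^ 2 ∂gaussianPair = P.sigma2 S i + P.mu S i ^ 2 := by
          rw [← chaosVar_T, add_comm]; exact el2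
        rw [this]

lemma U1_pos (hP : P.Admissible) (i : Fin d) : 0 < P.U1 S i := by
  have h1 := (hP.diag S).2.2.2.2 i
  have h2 : 0 < P.lam2 S i := pow_pos (S.lam_pos i) 2
  unfold U1
  positivity

/-- If the fluctuations of the `k`-th term vanish, so does its mean. -/
lemma mu_eq_zero_of_sigma2_eq_zero (hP : P.Admissible) (k : Fin d) (h : P.sigma2 S k = 0) :
    P.mu S k = 0 := by
  have hg := g_ne_zero S hP k
  have hl := (S.lam_pos k).ne'
  have hs := (noiseScale_pos S hP k).ne'
  have hz : P.T S 1 k = 0 ∧ P.T S 2 k = 0 ∧ P.T S 3 k = 0 ∧ P.T S 4 k = 0 ∧ P.T S 5 k = 0 := by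
    unfold sigma2 at h
    refine ⟨?_, ?_, ?_, ?_, ?_⟩ <;> refine pow_eq_zero_iff two_ne_zero |>.1 ?_ <;>
      nlinarith [sq_nonneg (P.T S 1 k), sq_nonneg (P.T S 2 k), sq_nonneg (P.T S 3 k),
        sq_nonneg (P.T S 4 k), sq_nonneg (P.T S 5 k)]
  obtain ⟨-, h2, h3, h4, -⟩ := hz
  have hr0 : P.r S k = 0 := by
    simp only [T, Matrix.cons_val] at h3
    simpa [hg] using h3
  have hh0 : P.hr S k = 0 := by
    simp only [T, Matrix.cons_val] at h2
    rw [root_eq S hP, hr0] at h2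
    simpa [hl, hs] using h2
  rw [mu, h3, h4]
  simp [T, hh0]

end SplittingMH

/-! ### Convergence of the expected acceptance probability -/

/-- A Gaussian approximation of `E[1 ∧ e^Z]` for sums `Z` of independent `chaos` variables with
uniformly negligible variances. Neither the mean `a d` nor the variance `V d` of `Z` is restricted,
but a degenerate `Z` has to vanish. -/
theorem tendsto_integral_min_one_exp_chaos (c : ∀ d : ℕ, Fin d → Fin 5 → ℝ) (a V ε : ℕ → ℝ)
    (hV : ∀ d, V d = ∑ k, chaosVar (c d k)) (ha : ∀ d, V d = 0 → a d = 0)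
    (hε : Tendsto ε atTop (𝓝 0)) (hc : ∀ᶠ d in atTop, ∀ k, chaosVar (c d k) ≤ ε d * V d) :
    Tendsto (fun d => ∫ ω : Fin d → ℝ × ℝ, min 1 (Real.exp (a d + ∑ k, chaos (c d k) (ω k)))
        ∂(Measure.pi fun _ => gaussianPair)
      - (Phi (a d / √(V d)) + Real.exp (a d + √(V d) ^ 2 / 2) * Phi (-√(V d) - a d / √(V d))))
      atTop (𝓝 0) := by
  have hV0 : ∀ d, 0 ≤ V d := fun d => by
    rw [hV]; exact Finset.sum_nonneg fun k _ => chaosVar_nonneg _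
  have hm : ∀ d, Measurable (fun ω : Fin d → ℝ × ℝ => (∑ k, chaos (c d k) (ω k)) / √(V d)) :=
    fun d => by fun_prop
  -- a degenerate sum is replaced by an exact normal variable
  let law : ℕ → Measure ℝ := fun d => if 0 < V d then
    (Measure.pi fun _ : Fin d => gaussianPair).map
      (fun ω => (∑ k, chaos (c d k) (ω k)) / √(V d)) else gaussianReal 0 1
  have hprob : ∀ d, IsProbabilityMeasure (law d) := by
    intro d
    dsimp only [law]
    split_ifs
    · exact Measure.isProbabilityMeasure_map (hm d).aemeasurable
    · infer_instance
  let lawP : ℕ → ProbabilityMeasure ℝ := fun d => ⟨law d, hprob d⟩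
  have hconv : Tendsto lawP atTop (𝓝 ⟨gaussianReal 0 1, inferInstance⟩) := by
    refine ProbabilityMeasure.tendsto_of_tendsto_charFun fun t => ?_
    rw [tendsto_iff_norm_sub_tendsto_zero]
    have hlim : Tendsto (fun d => 8 * |t| ^ 3 * chaosConst * √(ε d)) atTop (𝓝 0) := by
      have := (Real.continuous_sqrt.tendsto 0).comp hε
      simpa using this.const_mul (8 * |t| ^ 3 * chaosConst)
    refine squeeze_zero' (Eventually.of_forall fun _ => norm_nonneg _) (hc.mono fun d hd => ?_) hlim
    change ‖charFun (law d) t - charFun (gaussianReal 0 1) t‖ ≤ _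
    by_cases h : 0 < V d
    · simp only [law, if_pos h]
      exact norm_charFun_sum_chaos_sub_le (c d) (V d) (ε d) (hV d) h hd t
    · simp only [law, if_neg h, sub_self, norm_zero]
      exact mul_nonneg (mul_nonneg (by positivity) chaosConst_nonneg) (Real.sqrt_nonneg _)
  have hmain := tendsto_integral_sub_of_tendsto_gaussian lawP hconv
    (fun d y => min 1 (Real.exp (a d + √(V d) * y))) (fun d => by fun_prop)
    (fun d x y hxy => min_le_min_left _ (Real.exp_le_exp.2 (by gcongr)))
    (fun d x => (min_one_exp_mem _).1) (fun d x => (min_one_exp_mem _).2)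
  refine hmain.congr fun d => ?_
  change ∫ x, _ ∂(law d) - _ = _
  by_cases h : 0 < V d
  · have hs : 0 < √(V d) := Real.sqrt_pos.2 h
    rw [integral_min_one_exp_gaussian _ _ hs]
    simp only [law, if_pos h]
    rw [integral_map (hm d).aemeasurable (by fun_prop)]
    simp only [mul_div_cancel₀ _ hs.ne']
  · have hz : V d = 0 := le_antisymm (not_lt.1 h) (hV0 d)
    have hch : ∀ k p, chaos (c d k) p = 0 := by
      intro k p
      have h1 : chaosVar (c d k) = 0 := by
        have h2 := hV d
        rw [hz] at h2
        exact (Finset.sum_eq_zero_iff_of_nonneg fun k _ => chaosVar_nonneg _).1 h2.symm k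
          (Finset.mem_univ k)
      have h3 := abs_chaos_le (c d k) p
      rw [h1, Real.sqrt_zero, zero_mul] at h3
      exact abs_nonpos_iff.1 h3
    simp [law, hz, ha d hz, hch, Phi_zero]
    norm_num

namespace SplittingMH

/-- The Lyapunov condition makes every single coefficient negligible. -/
lemma T_sq_le {d : ℕ} (P : SplittingMH d) (S : SpectralDecomp P.A) {δ : ℝ} (hδ : 0 < δ)
    (j : Fin 6) (k : Fin d) :
    P.T S j k ^ 2 ≤ P.lyapunovRatio S δ j ^ (2 / (2 + δ)) * ∑ l, P.T S j l ^ 2 := by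
  set s := ∑ l, P.T S j l ^ 2 with hs
  have hle : P.T S j k ^ 2 ≤ s :=
    Finset.single_le_sum (f := fun l => P.T S j l ^ 2) (fun l _ => sq_nonneg _) (Finset.mem_univ k)
  have hs0 : 0 ≤ s := (sq_nonneg _).trans hle
  rcases hs0.eq_or_lt with h0 | hpos
  · rw [← h0] at hle ⊢
    simpa using hle
  have hd2 : 0 < 2 + δ := by linarith
  have hR : P.lyapunovRatio S δ j = (∑ l, |P.T S j l| ^ (2 + δ)) / s ^ (1 + δ / 2) := by
    simp only [lyapunovRatio, sq_abs, hs]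
  have hnum : |P.T S j k| ^ (2 + δ) ≤ ∑ l, |P.T S j l| ^ (2 + δ) :=
    Finset.single_le_sum (f := fun l => |P.T S j l| ^ (2 + δ))
      (fun l _ => Real.rpow_nonneg (abs_nonneg _) _) (Finset.mem_univ k)
  have h1 : |P.T S j k| ^ (2 + δ) ≤ P.lyapunovRatio S δ j * s ^ (1 + δ / 2) := by
    rw [hR, div_mul_cancel₀ _ (Real.rpow_pos_of_pos hpos _).ne']
    exact hnum
  have hR0 : 0 ≤ P.lyapunovRatio S δ j := by
    rw [hR]
    exact div_nonneg (Finset.sum_nonneg fun l _ => Real.rpow_nonneg (abs_nonneg _) _)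
      (Real.rpow_nonneg hs0 _)
  have h2 := Real.rpow_le_rpow (Real.rpow_nonneg (abs_nonneg _) _) h1
    (show 0 ≤ 2 / (2 + δ) by positivity)
  rw [Real.mul_rpow hR0 (Real.rpow_nonneg hs0 _), ← Real.rpow_mul (abs_nonneg _),
    ← Real.rpow_mul hs0] at h2
  have e1 : (2 + δ) * (2 / (2 + δ)) = 2 := by field_simp
  have e2 : (1 + δ / 2) * (2 / (2 + δ)) = 1 := by field_simp
  rw [e1, e2, Real.rpow_one, Real.rpow_two, sq_abs] at h2
  exact h2

/-- A bound, tending to `0` under the Lyapunov condition, on the fraction of the total variance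
that is carried by a single coordinate. -/
def maxFraction {d : ℕ} (P : SplittingMH d) (S : SpectralDecomp P.A) (δ : ℝ) : ℝ :=
  ∑ j : Fin 5, P.lyapunovRatio S δ j.succ ^ (2 / (2 + δ))

lemma lyapunovRatio_nonneg {d : ℕ} (P : SplittingMH d) (S : SpectralDecomp P.A) (δ : ℝ)
    (j : Fin 6) : 0 ≤ P.lyapunovRatio S δ j :=
  div_nonneg (Finset.sum_nonneg fun _ _ => Real.rpow_nonneg (abs_nonneg _) _)
    (Real.rpow_nonneg (Finset.sum_nonneg fun _ _ => sq_nonneg _) _)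

lemma sigma2_le {d : ℕ} (P : SplittingMH d) (S : SpectralDecomp P.A) {δ : ℝ} (hδ : 0 < δ)
    (k : Fin d) : P.sigma2 S k ≤ P.maxFraction S δ * ∑ l, P.sigma2 S l := by
  have h : ∀ j : Fin 5, P.T S j.succ k ^ 2 ≤ P.maxFraction S δ * ∑ l, P.T S j.succ l ^ 2 := by
    intro j
    refine (T_sq_le P S hδ j.succ k).trans (mul_le_mul_of_nonneg_right ?_
      (Finset.sum_nonneg fun _ _ => sq_nonneg _))
    exact Finset.single_le_sum (f := fun j : Fin 5 => P.lyapunovRatio S δ j.succ ^ (2 / (2 + δ)))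
      (fun j _ => Real.rpow_nonneg (lyapunovRatio_nonneg P S δ _) _) (Finset.mem_univ j)
  have h0 := h 0
  have h1 := h 1
  have h2 := h 2
  have h3 := h 3
  have h4 := h 4
  simp only [← chaosVar_T, chaosVar, Finset.sum_add_distrib, ← Finset.mul_sum]
  linarith

lemma sum_erase_eq_sum_ite {d i : ℕ} (h : i < d) (f : Fin d → ℝ) :
    ∑ k ∈ Finset.univ.erase (⟨i, h⟩ : Fin d), f k
      = ∑ k : Fin d, if (k : ℕ) = i then 0 else f k := by
  rw [← Finset.sum_erase Finset.univ (a := (⟨i, h⟩ : Fin d)) (by simp)]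
  refine Finset.sum_congr rfl fun k hk => ?_
  rw [if_neg]
  intro hki
  exact Finset.ne_of_mem_erase hk (Fin.ext hki)

/-- `U₂` is the value of the expected acceptance probability, without the `i`-th coordinate, when
the log-acceptance ratio is replaced by a normal variable of the same mean and variance. -/
theorem tendsto_restAccept_sub_U2 (P : ∀ d : ℕ, SplittingMH d) (hP : ∀ d, (P d).Admissible)
    (S : ∀ d : ℕ, SpectralDecomp (P d).A) {δ : ℝ} (hδ : 0 < δ)
    (hT : ∀ j : Fin 6, j ≠ 0 →
      Tendsto (fun d : ℕ => (P d).lyapunovRatio (S d) δ j) atTop (𝓝 0)) (i : ℕ) :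
    Tendsto (fun d : Set.Ioi i => (P d).restAccept (S d) ⟨i, d.2⟩ - (P d).U2 (S d) ⟨i, d.2⟩)
      atTop (𝓝 0) := by
  let c : ∀ d : ℕ, Fin d → Fin 5 → ℝ := fun d k =>
    if (k : ℕ) = i then 0 else fun j => (P d).T (S d) j.succ k
  let a : ℕ → ℝ := fun d => ∑ k : Fin d, if (k : ℕ) = i then 0 else (P d).mu (S d) k
  let V : ℕ → ℝ := fun d => ∑ k : Fin d, chaosVar (c d k)
  let ε : ℕ → ℝ := fun d => (P d).maxFraction (S d) δ
  have hcv : ∀ d k, chaosVar (c d k) = if (k : ℕ) = i then 0 else (P d).sigma2 (S d) k := by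
    intro d k
    dsimp only [c]
    split_ifs
    · simp [chaosVar]
    · exact chaosVar_T _ _ _
  have hσ0 : ∀ d k, 0 ≤ (P d).sigma2 (S d) k := fun d k => by
    rw [← chaosVar_T]; exact chaosVar_nonneg _
  have hε : Tendsto ε atTop (𝓝 0) := by
    have he : (0 : ℝ) = ∑ j : Fin 5, (0 : ℝ) ^ (2 / (2 + δ)) := by
      simp [Real.zero_rpow (show 2 / (2 + δ) ≠ 0 by positivity)]
    rw [he]
    refine tendsto_finsetSum _ fun j _ => ?_
    exact (hT j.succ (Fin.succ_ne_zero j)).rpow_const (Or.inr (by positivity))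
  have hc : ∀ᶠ d in atTop, ∀ k, chaosVar (c d k) ≤ 2 * ε d * V d := by
    filter_upwards [hε.eventually (gt_mem_nhds (show (0 : ℝ) < 1 / 2 by norm_num)),
      eventually_gt_atTop i] with d hd hid k
    have hε0 : 0 ≤ ε d :=
      Finset.sum_nonneg fun j _ => Real.rpow_nonneg (lyapunovRatio_nonneg _ _ _ _) _
    have hVe : V d = ∑ k ∈ Finset.univ.erase (⟨i, hid⟩ : Fin d), (P d).sigma2 (S d) k := by
      rw [sum_erase_eq_sum_ite]
      exact Finset.sum_congr rfl fun k _ => hcv d k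
    have hi := sigma2_le (P d) (S d) hδ ⟨i, hid⟩
    have hk := sigma2_le (P d) (S d) hδ k
    rw [← Finset.add_sum_erase _ _ (Finset.mem_univ (⟨i, hid⟩ : Fin d)), ← hVe] at hi hk
    have hσi := hσ0 d ⟨i, hid⟩
    change _ ≤ ε d * _ at hi
    change _ ≤ ε d * _ at hk
    -- the omitted coordinate carries at most half of the total variance
    have hσV : (P d).sigma2 (S d) ⟨i, hid⟩ ≤ V d := by
      have hV0 : 0 ≤ V d := Finset.sum_nonneg fun k _ => chaosVar_nonneg _
      nlinarith
    have hcs : chaosVar (c d k) ≤ (P d).sigma2 (S d) k := by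
      rw [hcv]; split_ifs
      · exact hσ0 d k
      · exact le_rfl
    nlinarith
  have ha : ∀ d, V d = 0 → a d = 0 := by
    intro d hd
    refine Finset.sum_eq_zero fun k _ => ?_
    have hk := (Finset.sum_eq_zero_iff_of_nonneg fun k _ => chaosVar_nonneg _).1 hd k
      (Finset.mem_univ k)
    rw [hcv] at hk
    split_ifs with h
    · rfl
    · rw [if_neg h] at hk
      exact mu_eq_zero_of_sigma2_eq_zero (S d) (hP d) k hk
  have hlim := tendsto_integral_min_one_exp_chaos c a V (fun d => 2 * ε d) (fun _ => rfl) ha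
    (by simpa using hε.const_mul 2) hc
  rw [← tendsto_comp_val_Ioi_atTop (a := i)] at hlim
  refine hlim.congr fun d => ?_
  have hd : i < (d : ℕ) := d.2
  have e1 : a d = (P d).muMinus (S d) ⟨i, d.2⟩ := (sum_erase_eq_sum_ite hd _).symm
  have e2 : √(V d) = (P d).sigmaMinus (S d) ⟨i, d.2⟩ := by
    rw [sigmaMinus, sum_erase_eq_sum_ite hd]
    congr 1
    exact Finset.sum_congr rfl fun k _ => hcv d k
  rw [U2, restAccept, ← e1, ← e2]
  congr 1
  refine integral_congr_ae (Eventually.of_forall fun ω => ?_)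
  dsimp only
  congr 2
  rw [sum_erase_eq_sum_ite hd (fun k => (P d).logTerm (S d) k (ω k)), ← Finset.sum_add_distrib]
  refine Finset.sum_congr rfl fun k _ => ?_
  dsimp only [c]
  split_ifs
  · simp [chaos]
  · rfl

end SplittingMH

end

theorem mainTheorem2
    (P : ∀ d : ℕ, SplittingMH d) (hP : ∀ d, (P d).Admissible)
    (S : ∀ d : ℕ, SpectralDecomp (P d).A)
    (hT : ∃ δ : ℝ, 0 < δ ∧ ∀ j : Fin 6, j ≠ 0 →
      Tendsto (fun d : ℕ => (P d).lyapunovRatio (S d) δ j) atTop (𝓝 0))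
    (i : ℕ) :
    (∀ d : Set.Ioi i,
      Integrable ((P d).sqJump ((S d).q ⟨i, d.2⟩)) (P d).stepLaw) ∧
    ∃ U₃ : Set.Ioi i → ℝ,
      (∀ d : Set.Ioi i, |U₃ d| ≤ (P d).U3bound (S d) ⟨i, d.2⟩) ∧
      Tendsto (fun d : Set.Ioi i =>
          ((P d).expSqJump ((S d).q ⟨i, d.2⟩) - U₃ d) / (P d).U1 (S d) ⟨i, d.2⟩
            - (P d).U2 (S d) ⟨i, d.2⟩)
        atTop (𝓝 0) ∧
      ((∃ C : ℝ, ∀ d : Set.Ioi i, (P d).U1 (S d) ⟨i, d.2⟩ ≤ C) →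
        Tendsto (fun d : Set.Ioi i =>
          (P d).expSqJump ((S d).q ⟨i, d.2⟩)
            - ((P d).U1 (S d) ⟨i, d.2⟩ * (P d).U2 (S d) ⟨i, d.2⟩ + U₃ d))
        atTop (𝓝 0)) := by
  obtain ⟨δ, hδ, hT⟩ := hT
  -- `U₃` is the exact error of leaving out the `i`-th coordinate from the acceptance probability
  have hlim := SplittingMH.tendsto_restAccept_sub_U2 P hP S hδ hT i
  refine ⟨fun d => ((P d).integrable_sqJump_and_expSqJump (S d) (hP d) _).1,
    fun d => (P d).expSqJump ((S d).q ⟨i, d.2⟩)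
      - (P d).U1 (S d) ⟨i, d.2⟩ * (P d).restAccept (S d) ⟨i, d.2⟩,
    fun d => SplittingMH.abs_expSqJump_sub_le (S d) (hP d) _, ?_, ?_⟩
  · refine hlim.congr fun d => ?_
    have := (SplittingMH.U1_pos (S d) (hP d) ⟨i, d.2⟩).ne'
    rw [sub_sub_cancel, mul_div_cancel_left₀ _ this]
  · rintro ⟨C, hC⟩
    have hb : Tendsto (fun d : Set.Ioi i => |C| *
        |(P d).restAccept (S d) ⟨i, d.2⟩ - (P d).U2 (S d) ⟨i, d.2⟩|) atTop (𝓝 0) := by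
      simpa using hlim.abs.const_mul |C|
    refine squeeze_zero_norm (fun d => ?_) hb
    have hpos := SplittingMH.U1_pos (S d) (hP d) ⟨i, d.2⟩
    have e : ∀ E u v w : ℝ, E - (u * v + (E - u * w)) = u * (w - v) := fun E u v w => by ring
    rw [e, Real.norm_eq_abs, abs_mul, abs_of_pos hpos]
    exact mul_le_mul_of_nonneg_right ((hC d).trans (le_abs_self C)) (abs_nonneg _)
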